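/- For complex $x,y,z$ in the plane cut along the nonpositive real axis, where one of them may also be $0$, let $$R_F(x,y,z)=\frac12\int_0^\infty (t+x)^{-1/2}(t+y)^{-1/2}(t+z)^{-1/2}\,dt$$ with principal branches. Let $x,y,z\in\mathbb C$, at most one of them $0$, the nonzero ones having phase less than $\pi$ in magnitude, and let $0<r<3\cdot 10^{-4}$. Put $x_0=x$, $y_0=y$, $z_0=z$, $$A_0=\frac{x+y+z}{3},\qquad Q=(3r)^{-1/6}\max\{|A_0-x|,|A_0-y|,|A_0-z|\},$$ and for $m=0,1,2,\dots$ $$\lambda_m=\sqrt{x_m}\sqrt{y_m}+\sqrt{x_m}\sqrt{z_m}+\sqrt{y_m}\sqrt{z_m},\qquad A_{m+1}=\frac{A_m+\lambda_m}{4},$$ $$x_{m+1}=\frac{x_m+\lambda_m}{4},\qquad y_{m+1}=\frac{y_m+\lambda_m}{4},\qquad z_{m+1}=\frac{z_m+\lambda_m}{4},$$ where each square root is the principal one (nonnegative real part). Then the integral defining $R_F(x,y,z)$ converges absolutely, and $4^{-n}Q<|A_n|$ holds for some $n\ge 1$. Let $n\ge 0$ be any integer with $4^{-n}Q<|A_n|$;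 if $n=0$, suppose in addition that the convex hull of $\{x,y,z\}$ lies in the union of $\{0\}$ and the cut plane. Put $$X=\frac{A_0-x}{4^nA_n},\qquad Y=\frac{A_0-y}{4^nA_n},\qquad Z=-X-Y,\qquad E_2=XY-Z^2,\qquad E_3=XYZ,$$ $$R=A_n^{-1/2}\left(1-\frac{E_2}{10}+\frac{E_3}{14}+\frac{E_2^2}{24}-\frac{3E_2E_3}{44}\right)$$ with the principal branch of $A_n^{-1/2}$. Then $R$ approximates $R_F(x,y,z)$ with relative error less than $r$, that is, $|R_F(x,y,z)-R|<r\,|R|$. -/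

import Mathlib

open MeasureTheory

namespace Carlson

noncomputable section

/-- The principal square root of a complex number: the square root with nonnegative real part. -/
def csqrt (w : ℂ) : ℂ := w ^ (1 / 2 : ℂ)

theorem csqrt_sq (w : ℂ) : csqrt w ^ 2 = w := by
  simp [csqrt]

theorem csqrt_re_nonneg (w : ℂ) : 0 ≤ (csqrt w).re := by
  by_cases hw : w = 0
  · simp [csqrt, hw]
  · rw [csqrt, Complex.cpow_def_of_ne_zero hw, Complex.exp_re]
    refine mul_nonneg (Real.exp_pos _).le (Real.cos_nonneg_of_mem_Icc ?_)
    have h1 := Complex.neg_pi_lt_arg w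
    have h2 := Complex.arg_le_pi w
    have h3 : (Complex.log w * (1 / 2)).im = w.arg / 2 := by
      have : (1 / 2 : ℂ) = ((1 / 2 : ℝ) : ℂ) := by push_cast; ring
      rw [this, Complex.im_mul_ofReal, Complex.log_im]
      ring
    rw [h3]
    constructor <;> linarith

/-- The integrand `[(t+x)(t+y)(t+z)]^{-1/2}` of the first symmetric elliptic integral. The branch is
the one that is positive for positive `x, y, z` and is continued continuously to complex `x, y, z`
in the plane cut along the nonpositive real axis: the product of the principal branches. -/
def integrandRF (x y z : ℂ) (t : ℝ) : ℂ :=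
  ((t : ℂ) + x) ^ (-1 / 2 : ℂ) * ((t : ℂ) + y) ^ (-1 / 2 : ℂ) * ((t : ℂ) + z) ^ (-1 / 2 : ℂ)

/-- The symmetric elliptic integral of the first kind. -/
def RF (x y z : ℂ) : ℂ := (1 / 2 : ℂ) * ∫ t in Set.Ioi (0 : ℝ), integrandRF x y z t

/-- `λ = √x √y + √x √z + √y √z`. -/
def lam (p : ℂ × ℂ × ℂ) : ℂ :=
  csqrt p.1 * csqrt p.2.1 + csqrt p.1 * csqrt p.2.2 + csqrt p.2.1 * csqrt p.2.2

/-- The triples `(x_m, y_m, z_m)` obtained from `(x, y, z)` by `m` duplication steps. -/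
def iter (x y z : ℂ) : ℕ → ℂ × ℂ × ℂ
  | 0 => (x, y, z)
  | m + 1 =>
    (((iter x y z m).1 + lam (iter x y z m)) / 4,
      ((iter x y z m).2.1 + lam (iter x y z m)) / 4,
      ((iter x y z m).2.2 + lam (iter x y z m)) / 4)

/-- `A_0 = (x + y + z) / 3` and `A_{m+1} = (A_m + λ_m) / 4`. -/
def A (x y z : ℂ) : ℕ → ℂ
  | 0 => (x + y + z) / 3
  | m + 1 => (A x y z m + lam (iter x y z m)) / 4

/-- `Q = (3r)^{-1/6} max {|A_0 - x|, |A_0 - y|, |A_0 - z|}`. -/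
def Q (r : ℝ) (x y z : ℂ) : ℝ :=
  (3 * r) ^ (-1 / 6 : ℝ) * max ‖A x y z 0 - x‖ (max ‖A x y z 0 - y‖ ‖A x y z 0 - z‖)

/-- The stopping criterion `4^{-n} Q < |A_n|`. -/
def Stop (r : ℝ) (x y z : ℂ) (n : ℕ) : Prop := Q r x y z / 4 ^ n < ‖A x y z n‖

def X (x y z : ℂ) (n : ℕ) : ℂ := (A x y z 0 - x) / (4 ^ n * A x y z n)

def Y (x y z : ℂ) (n : ℕ) : ℂ := (A x y z 0 - y) / (4 ^ n * A x y z n)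

def Z (x y z : ℂ) (n : ℕ) : ℂ := -X x y z n - Y x y z n

def E₂ (x y z : ℂ) (n : ℕ) : ℂ := X x y z n * Y x y z n - Z x y z n ^ 2

def E₃ (x y z : ℂ) (n : ℕ) : ℂ := X x y z n * Y x y z n * Z x y z n

/-- The value returned by the algorithm when it stops after `n` duplication steps. -/
def approxRF (x y z : ℂ) (n : ℕ) : ℂ :=
  A x y z n ^ (-1 / 2 : ℂ) *
    (1 - 1 / 10 * E₂ x y z n + 1 / 14 * E₃ x y z n + 1 / 24 * E₂ x y z n ^ 2
      - 3 / 44 * (E₂ x y z n * E₃ x y z n))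

end

end Carlson

/-!
The proof replaces contour deformation by one observation. Let `kern x y z w` be the product of the
principal branches of `(w + x)^{-1/2}`, `(w + y)^{-1/2}`, `(w + z)^{-1/2}`. Its integral
`kernTail x y z w` over the ray going from `w` to the right is a primitive of `-kern x y z`
(`hasDerivAt_kernTail`), and it tends to `0` along any path going to infinity away from the negative
real axis. By the fundamental theorem of calculus the ray may therefore be exchanged for such a
path (`kernTail_eq_integral`). Two paths are used.

* The path `t + λ(t + x, t + y, t + z)` starts at `λ(x, y, z)`, and along it the integrand becomes
  half that of `RF x y z`. This is the duplication theorem `RF_duplication`, so `RF` takes the same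
  value at all the iterates (`RF_iter`).
* The path `t a`, with `a` the mean `A_n`, gives
  `RF x_n y_n z_n = a^{-1/2} RF (1 - X) (1 - Y) (1 - Z)` (`HullCondition.RF_eq`). The branches match
  as long as the segments from `a` to `x_n`, `y_n`, `z_n` avoid the cut. For `n = 0` this is the
  hypothesis on the convex hull; for `n ≥ 1` it is automatic, because the iterates are products of
  pairs of numbers of the right half plane (`combination_mem_slitPlane`).

The stopping criterion is met because the real parts of the square roots of the iterates stay above
a positive constant while `A_n - x_n` tends to `0` (`exists_stop`).

It remains to expand `RF (1 - X) (1 - Y) (1 - Z)` for `X, Y, Z` of norm less than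
`ε = (3 r)^{1/6} < 0.311`. With `u = 1 / (t + 1)`, the integrand is `(t + 1)^{-3/2} (1 + w)^{-1/2}`,
where `w = E₂ u² - E₃ u³` is small because `X + Y + Z = 0`. The quadratic expansion of
`(1 + w)^{-1/2}`, stripped of its term in `E₃² u⁶`, integrates to the polynomial in `approxRF`, and
the error is at most `3.3 ε⁶ u⁶` (`norm_prod_sub_le`). Integration divides this by `13`, and
`3.3 / 13 · 3 r` is less than `r` times the norm of that polynomial, which is at least `0.97`.
-/

namespace Carlson

open Filter Topology Set

/-! ### The principal square root -/

theorem csqrt_zero : csqrt 0 = 0 := by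
  simpa using csqrt_sq 0

theorem csqrt_ne_zero {w : ℂ} (hw : w ≠ 0) : csqrt w ≠ 0 := by
  intro h
  apply hw
  rw [← csqrt_sq w, h]
  simp

theorem norm_csqrt_sq (w : ℂ) : ‖csqrt w‖ ^ 2 = ‖w‖ := by
  rw [← norm_pow, csqrt_sq]

theorem sq_notMem_slitPlane_of_re_eq_zero {s : ℂ} (hs : s.re = 0) :
    s ^ 2 ∉ Complex.slitPlane := by
  rw [Complex.mem_slitPlane_iff]
  simp only [sq, Complex.mul_re, Complex.mul_im, hs]
  push Not
  constructor
  · nlinarith [sq_nonneg s.im]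
  · ring

theorem sq_mem_slitPlane {s : ℂ} (hs : 0 < s.re) : s ^ 2 ∈ Complex.slitPlane := by
  rw [Complex.mem_slitPlane_iff]
  simp only [sq, Complex.mul_re, Complex.mul_im]
  by_cases h : s.im = 0
  · left
    rw [h]
    nlinarith
  · right
    intro h0
    have : s.re * s.im = 0 := by linarith
    rcases mul_eq_zero.1 this with h1 | h1
    · exact hs.ne' h1
    · exact h h1

theorem csqrt_re_pos {w : ℂ} (hw : w ∈ Complex.slitPlane) : 0 < (csqrt w).re := by
  refine lt_of_le_of_ne (csqrt_re_nonneg w) fun h => ?_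
  apply sq_notMem_slitPlane_of_re_eq_zero h.symm
  rwa [csqrt_sq]

theorem eq_csqrt_of_sq_eq {s w : ℂ} (hs : 0 < s.re) (h : s ^ 2 = w) : s = csqrt w := by
  rw [← csqrt_sq w] at h
  rcases sq_eq_sq_iff_eq_or_eq_neg.1 h with h | h
  · exact h
  · have h1 := csqrt_re_nonneg w
    rw [h, Complex.neg_re] at hs
    linarith

theorem csqrt_ofReal {t : ℝ} (ht : 0 < t) : csqrt (t : ℂ) = (√t : ℝ) := by
  symm
  apply eq_csqrt_of_sq_eq
  · simpa using ht
  · rw [← Complex.ofReal_pow, Real.sq_sqrt ht.le]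

/-- If `g` and `h` lie in the sector of phases less than `π / 4` in magnitude, then `g h` lies in
the right half plane, and `re (g h)` is at least the geometric mean of `re (g²)` and `re (h²)`. The
difference of the squares is `(re g · im h - im g · re h)²`. -/
theorem mul_re_pos_of_sq_re_pos {g h : ℂ} (hg : 0 ≤ g.re) (hh : 0 ≤ h.re)
    (hg2 : 0 < (g ^ 2).re) (hh2 : 0 < (h ^ 2).re) :
    0 < (g * h).re ∧ (g ^ 2).re * (h ^ 2).re ≤ (g * h).re ^ 2 := by
  simp only [sq, Complex.mul_re] at *
  have h1 : |g.im| < g.re := abs_lt_of_sq_lt_sq (by nlinarith) hg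
  have h2 : |h.im| < h.re := abs_lt_of_sq_lt_sq (by nlinarith) hh
  have h3 : |g.im| * |h.im| < g.re * h.re :=
    mul_lt_mul'' h1 h2 (abs_nonneg _) (abs_nonneg _)
  rw [← abs_mul] at h3
  refine ⟨by linarith [le_abs_self (g.im * h.im)], ?_⟩
  nlinarith [sq_nonneg (g.re * h.im - g.im * h.re)]

theorem csqrt_mul {u v : ℂ} (hu : 0 < u.re) (hv : 0 < v.re) :
    csqrt (u * v) = csqrt u * csqrt v := by
  symm
  apply eq_csqrt_of_sq_eq
  · refine (mul_re_pos_of_sq_re_pos (csqrt_re_nonneg u) (csqrt_re_nonneg v) ?_ ?_).1 <;>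
      rwa [csqrt_sq]
  · rw [mul_pow, csqrt_sq, csqrt_sq]

theorem mul_mem_slitPlane {u v : ℂ} (hu : 0 < u.re) (hv : 0 < v.re) :
    u * v ∈ Complex.slitPlane := by
  rw [← csqrt_sq u, ← csqrt_sq v, ← mul_pow]
  apply sq_mem_slitPlane
  refine (mul_re_pos_of_sq_re_pos (csqrt_re_nonneg u) (csqrt_re_nonneg v) ?_ ?_).1 <;>
      rwa [csqrt_sq]

theorem re_mul_csqrt_ge {u v : ℂ} {m : ℝ} (hm : 0 < m) (hu : m ≤ u.re) (hv : m ≤ v.re) :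
    m ≤ (csqrt (u * v)).re := by
  have hu' := hm.trans_le hu
  have hv' := hm.trans_le hv
  rw [csqrt_mul hu' hv']
  have h := mul_re_pos_of_sq_re_pos (csqrt_re_nonneg u) (csqrt_re_nonneg v)
    (by rwa [csqrt_sq]) (by rwa [csqrt_sq])
  rw [csqrt_sq, csqrt_sq] at h
  refine le_of_sq_le_sq ?_ h.1.le |>.trans' le_rfl
  nlinarith [h.2]

theorem hasDerivAt_csqrt {w : ℂ} (hw : w ∈ Complex.slitPlane) :
    HasDerivAt csqrt (1 / (2 * csqrt w)) w := by
  have h := (hasDerivAt_id w).cpow_const (c := 1 / 2) hw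
  have hne := Complex.slitPlane_ne_zero hw
  have hs := csqrt_ne_zero hne
  refine HasDerivAt.congr_deriv h ?_
  have e : (id w) ^ ((1 : ℂ) / 2 - 1) = csqrt w / w := by
    rw [Complex.cpow_sub _ _ (by simpa using hne)]
    simp [csqrt]
  rw [e]
  have h2 := csqrt_sq w
  field_simp
  linear_combination h2

theorem tendsto_csqrt_zero : Tendsto csqrt (𝓝 0) (𝓝 0) := by
  rw [tendsto_zero_iff_norm_tendsto_zero]
  have h : ∀ w, ‖csqrt w‖ = √‖w‖ := fun w => by
    rw [← norm_csqrt_sq w, Real.sqrt_sq (norm_nonneg _)]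
  simp_rw [h]
  have : ContinuousAt (fun w : ℂ => √‖w‖) 0 := by fun_prop
  simpa [ContinuousAt] using this

theorem continuousAt_csqrt {w : ℂ} (hw : w = 0 ∨ w ∈ Complex.slitPlane) :
    ContinuousAt csqrt w := by
  rcases hw with rfl | hw
  · simpa [ContinuousAt, csqrt_zero] using tendsto_csqrt_zero
  · exact (hasDerivAt_csqrt hw).continuousAt

theorem cpow_neg_half (w : ℂ) : w ^ (-1 / 2 : ℂ) = (csqrt w)⁻¹ := by
  rw [csqrt, ← Complex.cpow_neg]
  congr 1
  ring

/-! ### The integrand on translates of the positive axis -/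

/-- The function `[(w + x)(w + y)(w + z)]^{-1/2}` of a complex variable `w`, as a product of
principal branches. The integrand of `RF x y z` is its restriction to the positive axis. -/
noncomputable def kern (x y z w : ℂ) : ℂ :=
  (csqrt (w + x) * csqrt (w + y) * csqrt (w + z))⁻¹

theorem integrandRF_eq_kern (x y z : ℂ) (t : ℝ) : integrandRF x y z t = kern x y z t := by
  simp only [integrandRF, kern, cpow_neg_half, mul_inv]

theorem kern_add (x y z w v : ℂ) : kern (w + x) (w + y) (w + z) v = kern x y z (w + v) := by
  simp only [kern]
  congr 1
  ring_nf

theorem RF_eq_kern (x y z : ℂ) : RF x y z = 1 / 2 * ∫ t in Ioi (0 : ℝ), kern x y z t := by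
  simp only [RF, integrandRF_eq_kern]

theorem one_sub_mem_slitPlane {V : ℂ} (hV : ‖V‖ < 1) : 1 - V ∈ Complex.slitPlane := by
  rw [Complex.mem_slitPlane_iff, Complex.sub_re, Complex.one_re]
  exact .inl (by linarith [Complex.re_le_norm V])

theorem add_ofReal_mem_slitPlane {v : ℂ} (hv : v ∈ Complex.slitPlane) {t : ℝ} (ht : 0 ≤ t) :
    v + t ∈ Complex.slitPlane := by
  rw [Complex.mem_slitPlane_iff] at *
  simp only [Complex.add_re, Complex.ofReal_re, Complex.add_im, Complex.ofReal_im, add_zero]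
  rcases hv with h | h
  · left; linarith
  · right; exact h

theorem exists_mul_le_norm_add {v : ℂ} (hv : v ∈ Complex.slitPlane) :
    ∃ c : ℝ, 0 < c ∧ ∀ t : ℝ, 0 ≤ t → c * (1 + t) ≤ ‖v + t‖ := by
  obtain ⟨d, hd, hdt⟩ : ∃ d : ℝ, 0 < d ∧ ∀ t : ℝ, 0 ≤ t → d ≤ ‖v + t‖ := by
    rcases Complex.mem_slitPlane_iff.1 hv with h | h
    · refine ⟨v.re, h, fun t ht => le_trans ?_ (Complex.re_le_norm _)⟩
      simpa using ht
    · refine ⟨|v.im|, abs_pos.2 h, fun t _ => le_trans ?_ (Complex.abs_im_le_norm _)⟩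
      simp
  have hpos : 0 < 2 * ‖v‖ + 2 := by positivity
  -- the bound `d` serves for `t` up to `2 ‖v‖ + 1`, the bound `t - ‖v‖` beyond
  refine ⟨min (1 / 4) (d / (2 * ‖v‖ + 2)), by positivity, fun t ht => ?_⟩
  have h1t : 0 ≤ 1 + t := by linarith
  rcases le_total t (2 * ‖v‖ + 1) with h | h
  · calc _ ≤ d / (2 * ‖v‖ + 2) * (1 + t) := by gcongr; exact min_le_right _ _
      _ ≤ d / (2 * ‖v‖ + 2) * (2 * ‖v‖ + 2) :=
        mul_le_mul_of_nonneg_left (by linarith) (by positivity)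
      _ = d := by field_simp
      _ ≤ _ := hdt t ht
  · calc _ ≤ 1 / 4 * (1 + t) := by gcongr; exact min_le_left _ _
      _ ≤ t - ‖v‖ := by linarith [norm_nonneg v]
      _ = ‖(t : ℂ)‖ - ‖v‖ := by rw [Complex.norm_of_nonneg ht]
      _ ≤ ‖v + t‖ := by
        have := norm_sub_norm_le (t : ℂ) (-v)
        rw [norm_neg, sub_neg_eq_add, add_comm (t : ℂ)] at this
        exact this

theorem exists_forall_mul_le_norm_add {x y z : ℂ} (hx : x ∈ Complex.slitPlane)
    (hy : y ∈ Complex.slitPlane) (hz : z ∈ Complex.slitPlane) :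
    ∃ c : ℝ, 0 < c ∧ ∀ t : ℝ, 0 ≤ t →
      c * (1 + t) ≤ ‖x + t‖ ∧ c * (1 + t) ≤ ‖y + t‖ ∧ c * (1 + t) ≤ ‖z + t‖ := by
  obtain ⟨a, ha, hat⟩ := exists_mul_le_norm_add hx
  obtain ⟨b, hb, hbt⟩ := exists_mul_le_norm_add hy
  obtain ⟨c, hc, hct⟩ := exists_mul_le_norm_add hz
  refine ⟨min a (min b c), by positivity, fun t ht => ⟨?_, ?_, ?_⟩⟩
  · refine le_trans ?_ (hat t ht)
    gcongr
    exact min_le_left _ _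
  · refine le_trans ?_ (hbt t ht)
    gcongr
    exact (min_le_right _ _).trans (min_le_left _ _)
  · refine le_trans ?_ (hct t ht)
    gcongr
    exact (min_le_right _ _).trans (min_le_right _ _)

theorem sqrt_le_norm_csqrt {b : ℝ} {w : ℂ} (h : b ≤ ‖w‖) : √b ≤ ‖csqrt w‖ := by
  rw [← norm_csqrt_sq] at h
  exact Real.sqrt_le_iff.2 ⟨norm_nonneg _, h⟩

theorem norm_kern_le {x y z w : ℂ} {a b c : ℝ} (ha : 0 < a) (hb : 0 < b) (hc : 0 < c)
    (hx : a ≤ ‖w + x‖) (hy : b ≤ ‖w + y‖) (hz : c ≤ ‖w + z‖) :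
    ‖kern x y z w‖ ≤ (√a * √b * √c)⁻¹ := by
  rw [kern, norm_inv, norm_mul, norm_mul]
  have h1 := sqrt_le_norm_csqrt hx
  have h2 := sqrt_le_norm_csqrt hy
  have h3 := sqrt_le_norm_csqrt hz
  have := Real.sqrt_pos.2 ha
  have := Real.sqrt_pos.2 hb
  have := Real.sqrt_pos.2 hc
  gcongr

theorem inv_sqrt_cube {b : ℝ} (hb : 0 < b) : (√b * √b * √b)⁻¹ = b ^ (-3 / 2 : ℝ) := by
  rw [show (-3 / 2 : ℝ) = -(1 + 1 / 2) by norm_num, Real.rpow_neg hb.le, Real.rpow_add hb,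
    Real.rpow_one, ← Real.sqrt_eq_rpow, Real.mul_self_sqrt hb.le]

theorem norm_kern_le_rpow {x y z w : ℂ} {b : ℝ} (hb : 0 < b)
    (hx : b ≤ ‖w + x‖) (hy : b ≤ ‖w + y‖) (hz : b ≤ ‖w + z‖) :
    ‖kern x y z w‖ ≤ b ^ (-3 / 2 : ℝ) :=
  (norm_kern_le hb hb hb hx hy hz).trans_eq (inv_sqrt_cube hb)

/-- The derivative of `kern x y z`. -/
noncomputable def kernDeriv (x y z w : ℂ) : ℂ :=
  -(1 / 2) * kern x y z w * ((w + x)⁻¹ + (w + y)⁻¹ + (w + z)⁻¹)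

theorem hasDerivAt_kern {x y z w : ℂ} (hx : w + x ∈ Complex.slitPlane)
    (hy : w + y ∈ Complex.slitPlane) (hz : w + z ∈ Complex.slitPlane) :
    HasDerivAt (kern x y z) (kernDeriv x y z w) w := by
  have hd : ∀ {v : ℂ}, w + v ∈ Complex.slitPlane →
      HasDerivAt (fun u => csqrt (u + v)) (1 / (2 * csqrt (w + v))) w := fun {v} hv => by
    exact (hasDerivAt_csqrt hv).comp_add_const w v
  have hx0 := csqrt_ne_zero (Complex.slitPlane_ne_zero hx)
  have hy0 := csqrt_ne_zero (Complex.slitPlane_ne_zero hy)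
  have hz0 := csqrt_ne_zero (Complex.slitPlane_ne_zero hz)
  have h := (((hd hx).fun_mul (hd hy)).fun_mul (hd hz)).fun_inv
    (mul_ne_zero (mul_ne_zero hx0 hy0) hz0)
  refine HasDerivAt.congr_deriv h ?_
  rw [kernDeriv, kern]
  have hi : ∀ v, (w + v)⁻¹ = (csqrt (w + v) ^ 2)⁻¹ := fun v => by rw [csqrt_sq]
  rw [hi x, hi y, hi z]
  field_simp

theorem norm_kernDeriv_le {x y z w : ℂ} {b : ℝ} (hb : 0 < b)
    (hx : b ≤ ‖w + x‖) (hy : b ≤ ‖w + y‖) (hz : b ≤ ‖w + z‖) :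
    ‖kernDeriv x y z w‖ ≤ 3 / 2 * b ^ (-3 / 2 : ℝ) * b⁻¹ := by
  have hi : ∀ {v : ℂ}, b ≤ ‖v‖ → ‖v⁻¹‖ ≤ b⁻¹ := fun h => by
    rw [norm_inv]
    gcongr
  have h3 : ‖(w + x)⁻¹ + (w + y)⁻¹ + (w + z)⁻¹‖ ≤ 3 * b⁻¹ := by
    refine (norm_add₃_le).trans ?_
    linarith [hi hx, hi hy, hi hz]
  rw [kernDeriv, norm_mul, norm_mul]
  calc _ ≤ 1 / 2 * b ^ (-3 / 2 : ℝ) * (3 * b⁻¹) := by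
        gcongr
        · norm_num
        · exact norm_kern_le_rpow hb hx hy hz
    _ = _ := by ring

theorem continuousAt_kern {x y z : ℂ} {t : ℝ} (hx : (t : ℂ) + x ∈ Complex.slitPlane)
    (hy : (t : ℂ) + y ∈ Complex.slitPlane) (hz : (t : ℂ) + z ∈ Complex.slitPlane) :
    ContinuousAt (fun t : ℝ => kern x y z t) t :=
  (hasDerivAt_kern hx hy hz).continuousAt.comp (f := fun t : ℝ => (t : ℂ))
    Complex.continuous_ofReal.continuousAt

theorem add_mem_slitPlane_of_eq_zero_or {x : ℂ} (hx : x = 0 ∨ x ∈ Complex.slitPlane) {t : ℝ}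
    (ht : 0 < t) : (t : ℂ) + x ∈ Complex.slitPlane := by
  rcases hx with rfl | hx
  · simpa using ht
  · rw [add_comm]
    exact add_ofReal_mem_slitPlane hx ht.le

theorem exists_mul_le_norm_add_of_eq_zero_or {x : ℂ} (hx : x = 0 ∨ x ∈ Complex.slitPlane) :
    ∃ c : ℝ, 0 < c ∧ ∀ t : ℝ, 0 < t → c * t ≤ ‖(t : ℂ) + x‖ := by
  rcases hx with rfl | hx
  · exact ⟨1, one_pos, fun t ht => by simp [abs_of_pos ht]⟩
  · obtain ⟨c, hc, h⟩ := exists_mul_le_norm_add hx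
    refine ⟨c, hc, fun t ht => ?_⟩
    rw [add_comm]
    refine le_trans ?_ (h t ht.le)
    gcongr
    linarith

/-- The function is the derivative of `2 arctan √t`. -/
theorem integrableOn_inv_sqrt_mul_one_add :
    IntegrableOn (fun t : ℝ => (√t * (1 + t))⁻¹) (Ioi 0) := by
  have h : IntegrableOn (fun t : ℝ => 1 / (1 + √t ^ 2) * (1 / (2 * √t))) (Ioi 0) := by
    refine integrableOn_Ioi_deriv_of_nonneg (g := fun t => Real.arctan √t) (l := Real.pi / 2)
      ?_ ?_ ?_ ?_
    · exact (Real.continuous_arctan.comp Real.continuous_sqrt).continuousWithinAt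
    · intro t ht
      exact (Real.hasDerivAt_sqrt (ne_of_gt ht)).arctan
    · intro t ht
      positivity
    · exact (Real.tendsto_arctan_atTop.mono_right nhdsWithin_le_nhds).comp
        Real.tendsto_sqrt_atTop
  refine IntegrableOn.congr_fun (h.const_mul 2) (fun t ht => ?_) measurableSet_Ioi
  have ht0 : (0 : ℝ) < t := ht
  have := Real.sqrt_pos.2 ht0
  simp only [Real.sq_sqrt ht0.le]
  field_simp

theorem integrableOn_kern_of_mem_slitPlane {x y z : ℂ} (hx : x = 0 ∨ x ∈ Complex.slitPlane)
    (hy : y ∈ Complex.slitPlane) (hz : z ∈ Complex.slitPlane) :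
    IntegrableOn (fun t : ℝ => kern x y z t) (Ioi 0) := by
  obtain ⟨a, ha, hat⟩ := exists_mul_le_norm_add_of_eq_zero_or hx
  obtain ⟨b, hb, hbt⟩ := exists_mul_le_norm_add hy
  obtain ⟨c, hc, hct⟩ := exists_mul_le_norm_add hz
  refine Integrable.mono' (integrableOn_inv_sqrt_mul_one_add.const_mul (√a * √b * √c)⁻¹) ?_ ?_
  · refine ContinuousOn.aestronglyMeasurable (fun t ht => ?_) measurableSet_Ioi
    exact (continuousAt_kern (add_mem_slitPlane_of_eq_zero_or hx ht)
      (add_mem_slitPlane_of_eq_zero_or (.inr hy) ht)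
      (add_mem_slitPlane_of_eq_zero_or (.inr hz) ht)).continuousWithinAt
  · refine (ae_restrict_iff' measurableSet_Ioi).2 (ae_of_all _ fun t ht => ?_)
    have ht0 : (0 : ℝ) < t := ht
    have h1t : 0 < 1 + t := by linarith
    have h1 := hbt t ht0.le
    have h2 := hct t ht0.le
    rw [add_comm y] at h1
    rw [add_comm z] at h2
    refine (norm_kern_le (by positivity) (by positivity) (by positivity) (hat t ht) h1 h2).trans
      (le_of_eq ?_)
    rw [Real.sqrt_mul ha.le, Real.sqrt_mul hb.le, Real.sqrt_mul hc.le]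
    rw [← mul_inv]
    congr 1
    have := Real.mul_self_sqrt h1t.le
    linear_combination (√a * √t * √b * √c) * this

theorem kern_comm₁₂ (x y z w : ℂ) : kern x y z w = kern y x z w := by
  simp only [kern]; ring_nf

theorem kern_comm₁₃ (x y z w : ℂ) : kern x y z w = kern z y x w := by
  simp only [kern]; ring_nf

/-- The admissible arguments of `RF`: each one is `0` or in the cut plane, and at most one is
`0`. -/
def Admissible (x y z : ℂ) : Prop :=
  (x = 0 ∨ x ∈ Complex.slitPlane) ∧ (y = 0 ∨ y ∈ Complex.slitPlane) ∧
    (z = 0 ∨ z ∈ Complex.slitPlane) ∧ (x ≠ 0 ∨ y ≠ 0) ∧ (x ≠ 0 ∨ z ≠ 0) ∧ (y ≠ 0 ∨ z ≠ 0)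

theorem Admissible.of_mem_slitPlane {x y z : ℂ} (hx : x ∈ Complex.slitPlane)
    (hy : y ∈ Complex.slitPlane) (hz : z ∈ Complex.slitPlane) : Admissible x y z :=
  ⟨.inr hx, .inr hy, .inr hz, .inl (Complex.slitPlane_ne_zero hx),
    .inl (Complex.slitPlane_ne_zero hx), .inl (Complex.slitPlane_ne_zero hy)⟩

theorem Admissible.integrableOn_kern {x y z : ℂ} (h : Admissible x y z) :
    IntegrableOn (fun t : ℝ => kern x y z t) (Ioi 0) := by
  obtain ⟨hx, hy, hz, hxy, hxz, hyz⟩ := h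
  rcases hx with rfl | hx
  · simp only [ne_eq, not_true_eq_false, false_or] at hxy hxz
    exact integrableOn_kern_of_mem_slitPlane (.inl rfl) (hy.resolve_left hxy) (hz.resolve_left hxz)
  · rcases hy with rfl | hy
    · simp only [ne_eq, not_true_eq_false, false_or] at hyz
      simp_rw [kern_comm₁₂ x]
      exact integrableOn_kern_of_mem_slitPlane (.inl rfl) hx (hz.resolve_left hyz)
    · simp_rw [kern_comm₁₃ x]
      exact integrableOn_kern_of_mem_slitPlane hz hy hx

/-! ### Moving the path of integration -/

theorem integral_add_rpow_Ioi {a T : ℝ} (ha : a < -1) (hT : 0 < T) :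
    ∫ u in Ioi (0 : ℝ), (u + T) ^ a = -T ^ (a + 1) / (a + 1) := by
  have h : ∫ u in Ioi (0 : ℝ), (u + T) ^ a = 0 - (0 + T) ^ (a + 1) / (a + 1) := by
    refine integral_Ioi_of_hasDerivAt_of_tendsto' (f := fun u => (u + T) ^ (a + 1) / (a + 1))
      (fun u hu => ?_) (integrableOn_add_rpow_Ioi_of_lt ha (by linarith)) ?_
    · have hu0 : (0 : ℝ) ≤ u := hu
      have h := (((hasDerivAt_id u).add_const T).rpow_const (p := a + 1)
        (.inl (by simp only [id]; linarith))).div_const (a + 1)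
      refine h.congr_deriv ?_
      have : a + 1 ≠ 0 := by linarith
      simp only [id, add_sub_cancel_right]
      field_simp
    · have h := (tendsto_rpow_neg_atTop (y := -(a + 1)) (by linarith)).comp
        (tendsto_atTop_add_const_right atTop T tendsto_id)
      simpa [Function.comp_def] using h.div_const (a + 1)
  rw [h]
  simp [neg_div]

/-- The integral of `kern x y z` along the horizontal ray from `w` to the right. As a function of
`w` it is a primitive of `-kern x y z`, which replaces contour deformation. -/
noncomputable def kernTail (x y z w : ℂ) : ℂ := ∫ t in Ioi (0 : ℝ), kern x y z (w + t)

theorem RF_add (x y z w : ℂ) : RF (w + x) (w + y) (w + z) = 1 / 2 * kernTail x y z w := by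
  rw [RF_eq_kern, kernTail]
  simp only [kern_add]

theorem aestronglyMeasurable_of_continuousAt_pos {f : ℝ → ℂ}
    (h : ∀ t : ℝ, 0 < t → ContinuousAt f t) :
    AEStronglyMeasurable f (volume.restrict (Ioi 0)) :=
  ContinuousOn.aestronglyMeasurable (fun t ht => (h t ht).continuousWithinAt) measurableSet_Ioi

/-- Differentiation under the integral sign gives the integral of the derivative of `kern x y z`
along the ray, which the fundamental theorem of calculus evaluates. -/
theorem hasDerivAt_kernTail {x y z w : ℂ} (hx : w + x ∈ Complex.slitPlane)
    (hy : w + y ∈ Complex.slitPlane) (hz : w + z ∈ Complex.slitPlane) :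
    HasDerivAt (kernTail x y z) (-kern x y z w) w := by
  obtain ⟨c, hc, hct⟩ := exists_forall_mul_le_norm_add hx hy hz
  -- on this neighbourhood of `w` the lower bound `hct` survives with half the constant
  set s : Set ℂ := Metric.ball w (c / 2) ∩ ({v | v + x ∈ Complex.slitPlane} ∩
    ({v | v + y ∈ Complex.slitPlane} ∩ {v | v + z ∈ Complex.slitPlane})) with hs
  have hopen : ∀ v : ℂ, IsOpen {u : ℂ | u + v ∈ Complex.slitPlane} := fun v =>
    Complex.isOpen_slitPlane.preimage (continuous_add_const v)
  have hsw : s ∈ 𝓝 w := by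
    refine IsOpen.mem_nhds ?_ ⟨Metric.mem_ball_self (by positivity), hx, hy, hz⟩
    exact Metric.isOpen_ball.inter ((hopen x).inter ((hopen y).inter (hopen z)))
  have hslit : ∀ v u : ℂ, v + u ∈ Complex.slitPlane → ∀ t : ℝ, 0 ≤ t →
      v + t + u ∈ Complex.slitPlane := fun v u h t ht => by
    rw [add_right_comm]
    exact add_ofReal_mem_slitPlane h ht
  have hlow : ∀ v ∈ s, ∀ u : ℂ, ∀ t : ℝ, 0 ≤ t → c * (1 + t) ≤ ‖w + u + t‖ →
      c / 2 * (t + 1) ≤ ‖v + t + u‖ := fun v hv u t ht h => by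
    have h1 : ‖w - v‖ < c / 2 := by
      rw [norm_sub_rev]
      exact mem_ball_iff_norm.1 hv.1
    have h2 : ‖w + u + t‖ ≤ ‖v + t + u‖ + ‖w - v‖ := by
      refine le_trans (le_of_eq ?_) (norm_add_le _ _)
      ring_nf
    nlinarith [mul_nonneg hc.le ht]
  have hcont : ∀ v ∈ s, ∀ t : ℝ, 0 < t → ContinuousAt (fun t : ℝ => kern x y z (v + t)) t :=
    fun v hv t ht => (hasDerivAt_kern (hslit v x hv.2.1 t ht.le) (hslit v y hv.2.2.1 t ht.le)
      (hslit v z hv.2.2.2 t ht.le)).continuousAt.comp (f := fun t : ℝ => v + (t : ℂ)) (by fun_prop)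
  have hws := mem_of_mem_nhds hsw
  have hint : Integrable (fun t : ℝ => kern x y z (w + t)) (volume.restrict (Ioi 0)) := by
    have := (Admissible.of_mem_slitPlane hx hy hz).integrableOn_kern
    simp only [kern_add] at this
    exact this
  have hbd : ∀ t : ℝ, 0 < t → ∀ v ∈ s,
      ‖kernDeriv x y z (v + t)‖ ≤ 3 / 2 * (c / 2) ^ (-3 / 2 : ℝ) * (c / 2)⁻¹ *
        (t + 1) ^ (-5 / 2 : ℝ) := fun t ht v hv => by
    have h := hct t ht.le
    have ht1 : 0 < t + 1 := by linarith
    refine (norm_kernDeriv_le (b := c / 2 * (t + 1)) (by positivity) (hlow v hv x t ht.le h.1)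
      (hlow v hv y t ht.le h.2.1) (hlow v hv z t ht.le h.2.2)).trans (le_of_eq ?_)
    rw [Real.mul_rpow (by positivity) ht1.le, show (-5 / 2 : ℝ) = -3 / 2 + -1 by norm_num,
      Real.rpow_add ht1, Real.rpow_neg_one, mul_inv]
    ring
  have hmeas' : AEStronglyMeasurable (fun t : ℝ => kernDeriv x y z (w + t))
      (volume.restrict (Ioi 0)) := by
    refine aestronglyMeasurable_of_continuousAt_pos fun t ht => ?_
    have hinv : ∀ u : ℂ, w + u ∈ Complex.slitPlane →
        ContinuousAt (fun t : ℝ => (w + t + u)⁻¹) t := fun u hu =>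
      ContinuousAt.inv₀ (by fun_prop) (Complex.slitPlane_ne_zero (hslit w u hu t ht.le))
    exact ((hcont w hws t ht).const_mul _).mul (((hinv x hx).add (hinv y hy)).add (hinv z hz))
  obtain ⟨hint', hder⟩ := hasDerivAt_integral_of_dominated_loc_of_deriv_le
    (μ := volume.restrict (Ioi (0 : ℝ))) (F := fun v (t : ℝ) => kern x y z (v + t))
    (F' := fun v (t : ℝ) => kernDeriv x y z (v + t)) hsw
    (eventually_of_mem hsw fun v hv => aestronglyMeasurable_of_continuousAt_pos (hcont v hv))
    hint hmeas'
    ((ae_restrict_iff' measurableSet_Ioi).2 (ae_of_all _ fun t ht v hv => hbd t ht v hv))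
    ((integrableOn_add_rpow_Ioi_of_lt (by norm_num) (by norm_num)).const_mul _)
    ((ae_restrict_iff' measurableSet_Ioi).2 (ae_of_all _ fun t ht v hv => by
      have ht0 : (0 : ℝ) ≤ t := le_of_lt ht
      exact (hasDerivAt_kern (hslit v x hv.2.1 t ht0) (hslit v y hv.2.2.1 t ht0)
        (hslit v z hv.2.2.2 t ht0)).comp_add_const v t))
  refine hder.congr_deriv ?_
  have hd : ∀ t ∈ Ici (0 : ℝ), HasDerivAt (fun t : ℝ => kern x y z (w + t))
      (kernDeriv x y z (w + t)) t := fun t ht => by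
    have h := (hasDerivAt_kern (hslit w x hx t ht) (hslit w y hy t ht)
      (hslit w z hz t ht)).comp_const_add w (t : ℂ)
    exact h.comp_ofReal
  have hlim : Tendsto (fun t : ℝ => kern x y z (w + t)) atTop (𝓝 0) := by
    have hR : Tendsto (fun t : ℝ => (c / 2 * (t + 1)) ^ (-3 / 2 : ℝ)) atTop (𝓝 0) := by
      have h := (tendsto_rpow_neg_atTop (y := 3 / 2) (by norm_num)).comp
        ((tendsto_atTop_add_const_right atTop 1 tendsto_id).const_mul_atTop (half_pos hc))
      simpa [Function.comp_def, neg_div] using h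
    refine squeeze_zero_norm' ?_ hR
    filter_upwards [eventually_ge_atTop 0] with t ht
    have h := hct t ht
    exact norm_kern_le_rpow (by positivity) (hlow w hws x t ht h.1)
      (hlow w hws y t ht h.2.1) (hlow w hws z t ht h.2.2)
  have := integral_Ioi_of_hasDerivAt_of_tendsto' hd hint' hlim
  rw [this]
  simp

theorem tendsto_kernTail_comp (x y z : ℂ) {γ : ℝ → ℂ} {c : ℝ} (hc : 0 < c)
    (hγ : ∀ᶠ t in atTop, ∀ u : ℝ, 0 ≤ u → c * (t + u) ≤ ‖γ t + u‖) :
    Tendsto (fun t => kernTail x y z (γ t)) atTop (𝓝 0) := by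
  set M := max ‖x‖ (max ‖y‖ ‖z‖) with hM
  have hxM : ‖x‖ ≤ M := le_max_left _ _
  have hyM : ‖y‖ ≤ M := (le_max_left _ _).trans (le_max_right _ _)
  have hzM : ‖z‖ ≤ M := (le_max_right _ _).trans (le_max_right _ _)
  have hR : Tendsto (fun t : ℝ => (c / 2) ^ (-3 / 2 : ℝ) * (2 * t ^ (-(1 / 2) : ℝ))) atTop
      (𝓝 0) := by
    simpa using ((tendsto_rpow_neg_atTop (y := 1 / 2) (by norm_num)).const_mul 2).const_mul
      ((c / 2) ^ (-3 / 2 : ℝ))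
  refine squeeze_zero_norm' ?_ hR
  filter_upwards [hγ, eventually_gt_atTop 0, eventually_ge_atTop (2 * M / c)] with t ht ht0 htM
  have hlow : ∀ v : ℂ, ‖v‖ ≤ M → ∀ u : ℝ, 0 < u → c / 2 * (u + t) ≤ ‖γ t + u + v‖ :=
    fun v hv u hu => by
    have h1 := ht u hu.le
    have h2 : ‖γ t + u‖ ≤ ‖γ t + u + v‖ + ‖v‖ := by
      have := norm_sub_le (γ t + u + v) v
      rwa [add_sub_cancel_right] at this
    rw [div_le_iff₀ hc] at htM
    nlinarith [mul_pos hc hu]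
  have hint := (integrableOn_add_rpow_Ioi_of_lt (a := -3 / 2) (m := t) (c := 0) (by norm_num)
    (by linarith)).const_mul ((c / 2) ^ (-3 / 2 : ℝ))
  refine (norm_integral_le_of_norm_le hint ?_).trans (le_of_eq ?_)
  · refine (ae_restrict_iff' measurableSet_Ioi).2 (ae_of_all _ fun u hu => ?_)
    have hu0 : (0 : ℝ) < u := hu
    have hb : 0 < c / 2 * (u + t) := by positivity
    rw [← Real.mul_rpow (by positivity) (by linarith)]
    exact norm_kern_le_rpow hb (hlow x hxM u hu) (hlow y hyM u hu) (hlow z hzM u hu)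
  · rw [integral_const_mul, integral_add_rpow_Ioi (by norm_num) ht0,
      show (-3 / 2 : ℝ) + 1 = -(1 / 2) by norm_num]
    ring

/-- Deformation of the path of integration: the horizontal ray from `γ 0` may be replaced by a path
`γ` that goes to infinity away from the negative real axis. This holds because
`t ↦ kernTail x y z (γ t)` is, up to sign, a primitive of the integrand along `γ` and vanishes at
infinity. -/
theorem kernTail_eq_integral {x y z : ℂ} {γ γ' : ℝ → ℂ} {c : ℝ} (hc : 0 < c)
    (hγ : ∀ᶠ t in atTop, ∀ u : ℝ, 0 ≤ u → c * (t + u) ≤ ‖γ t + u‖)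
    (h0 : ContinuousWithinAt γ (Ici 0) 0) (hd : ∀ t, 0 < t → HasDerivAt γ (γ' t) t)
    (hx : ∀ t, 0 ≤ t → γ t + x ∈ Complex.slitPlane)
    (hy : ∀ t, 0 ≤ t → γ t + y ∈ Complex.slitPlane)
    (hz : ∀ t, 0 ≤ t → γ t + z ∈ Complex.slitPlane)
    (hint : IntegrableOn (fun t => kern x y z (γ t) * γ' t) (Ioi 0)) :
    kernTail x y z (γ 0) = ∫ t in Ioi (0 : ℝ), kern x y z (γ t) * γ' t := by
  have hJ : ∀ t, 0 ≤ t → HasDerivAt (kernTail x y z) (-kern x y z (γ t)) (γ t) := fun t ht =>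
    hasDerivAt_kernTail (hx t ht) (hy t ht) (hz t ht)
  have h := integral_Ioi_of_hasDerivAt_of_tendsto (f := fun t => kernTail x y z (γ t))
    (f' := fun t => -(kern x y z (γ t) * γ' t)) (a := 0)
    ((hJ 0 le_rfl).continuousAt.comp_continuousWithinAt h0)
    (fun t ht => by
      have := (hJ t (le_of_lt ht)).comp t (hd t ht)
      simpa [Function.comp_def] using this)
    hint.neg (tendsto_kernTail_comp x y z hc hγ)
  rw [integral_neg, zero_sub, neg_inj] at h
  exact h.symm

/-! ### Homogeneity and the duplication theorem -/

/-- `RF` is homogeneous of degree `-1/2` under a complex factor `A`, as long as the principal square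
roots are multiplicative for `A` and all points of the rays of integration. The path of integration
is turned from the positive axis to the ray through `A`. -/
theorem RF_mul {A x y z : ℂ} (hA : A ∈ Complex.slitPlane) (hx : x ∈ Complex.slitPlane)
    (hy : y ∈ Complex.slitPlane) (hz : z ∈ Complex.slitPlane)
    (hAx : ∀ t : ℝ, 0 ≤ t → A * (t + x) ∈ Complex.slitPlane ∧
      csqrt (A * (t + x)) = csqrt A * csqrt (t + x))
    (hAy : ∀ t : ℝ, 0 ≤ t → A * (t + y) ∈ Complex.slitPlane ∧
      csqrt (A * (t + y)) = csqrt A * csqrt (t + y))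
    (hAz : ∀ t : ℝ, 0 ≤ t → A * (t + z) ∈ Complex.slitPlane ∧
      csqrt (A * (t + z)) = csqrt A * csqrt (t + z)) :
    RF (A * x) (A * y) (A * z) = (csqrt A)⁻¹ * RF x y z := by
  have hA0 := csqrt_ne_zero (Complex.slitPlane_ne_zero hA)
  have hk : ∀ t : ℝ, 0 < t →
      kern (A * x) (A * y) (A * z) (t * A) * A = (csqrt A)⁻¹ * kern x y z t := fun t ht => by
    have e : ∀ v, (t : ℂ) * A + A * v = A * (t + v) := fun v => by ring
    simp only [kern, e, (hAx t ht.le).2, (hAy t ht.le).2, (hAz t ht.le).2]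
    nth_rewrite 4 [← csqrt_sq A]
    field_simp
  obtain ⟨c, hc, hct⟩ := exists_mul_le_norm_add hA
  have hint : IntegrableOn (fun t : ℝ => kern (A * x) (A * y) (A * z) (t * A) * A) (Ioi 0) :=
    IntegrableOn.congr_fun
      ((Admissible.of_mem_slitPlane hx hy hz).integrableOn_kern.const_mul (csqrt A)⁻¹)
      (fun t ht => (hk t ht).symm) measurableSet_Ioi
  have e : ∀ (t : ℝ) v, (t : ℂ) * A + A * v = A * (t + v) := fun t v => by ring
  have h := kernTail_eq_integral (γ := fun t : ℝ => (t : ℂ) * A) (γ' := fun _ => A) hc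
    (by
      filter_upwards [eventually_gt_atTop 0] with t ht u hu
      have h1 := hct (u / t) (by positivity)
      have h2 : (t : ℂ) * A + u = t * (A + ((u / t : ℝ) : ℂ)) := by
        have : (t : ℂ) ≠ 0 := by exact_mod_cast ht.ne'
        push_cast
        field_simp
      rw [h2, norm_mul, Complex.norm_of_nonneg ht.le]
      calc c * (t + u) = t * (c * (1 + u / t)) := by field_simp
        _ ≤ _ := by gcongr)
    (by fun_prop)
    (fun t _ => by simpa using (Complex.ofRealCLM.hasDerivAt (x := t)).mul_const A)
    (fun t ht => by rw [e]; exact (hAx t ht).1) (fun t ht => by rw [e]; exact (hAy t ht).1)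
    (fun t ht => by rw [e]; exact (hAz t ht).1) hint
  have h2 := RF_add (A * x) (A * y) (A * z) 0
  simp only [zero_add] at h2
  simp only [Complex.ofReal_zero, zero_mul] at h
  rw [h2, h, setIntegral_congr_fun measurableSet_Ioi hk, integral_const_mul, RF_eq_kern]
  ring

theorem csqrt_mul_ofReal {k : ℝ} (hk : 0 < k) {v : ℂ} (hv : v ∈ Complex.slitPlane) :
    csqrt (k * v) = csqrt k * csqrt v := by
  symm
  apply eq_csqrt_of_sq_eq
  · rw [csqrt_ofReal hk, Complex.re_ofReal_mul]
    exact mul_pos (Real.sqrt_pos.2 hk) (csqrt_re_pos hv)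
  · rw [mul_pow, csqrt_sq, csqrt_sq]

theorem ofReal_mul_mem_slitPlane {k : ℝ} (hk : 0 < k) {v : ℂ} (hv : v ∈ Complex.slitPlane) :
    (k : ℂ) * v ∈ Complex.slitPlane := by
  rw [Complex.mem_slitPlane_iff] at *
  rw [Complex.re_ofReal_mul, Complex.im_ofReal_mul]
  exact hv.imp (mul_pos hk) (mul_ne_zero hk.ne')

theorem Admissible.add_ofReal {x y z : ℂ} (h : Admissible x y z) {t : ℝ} (ht : 0 ≤ t) :
    Admissible (t + x) (t + y) (t + z) := by
  rcases ht.eq_or_lt with rfl | ht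
  · simpa using h
  · exact .of_mem_slitPlane (add_mem_slitPlane_of_eq_zero_or h.1 ht)
      (add_mem_slitPlane_of_eq_zero_or h.2.1 ht) (add_mem_slitPlane_of_eq_zero_or h.2.2.1 ht)

theorem csqrt_add_csqrt_re_pos {x y : ℂ} (hx : x = 0 ∨ x ∈ Complex.slitPlane)
    (hy : y = 0 ∨ y ∈ Complex.slitPlane) (hxy : x ≠ 0 ∨ y ≠ 0) :
    0 < (csqrt x + csqrt y).re := by
  rw [Complex.add_re]
  rcases hxy with h | h
  · have := csqrt_re_pos (hx.resolve_left h)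
    linarith [csqrt_re_nonneg y]
  · have := csqrt_re_pos (hy.resolve_left h)
    linarith [csqrt_re_nonneg x]

theorem add_lam_eq₁ (x y z : ℂ) :
    x + lam (x, y, z) = (csqrt x + csqrt y) * (csqrt x + csqrt z) := by
  rw [lam]
  linear_combination -csqrt_sq x

theorem add_lam_eq₂ (x y z : ℂ) :
    y + lam (x, y, z) = (csqrt x + csqrt y) * (csqrt y + csqrt z) := by
  rw [lam]
  linear_combination -csqrt_sq y

theorem add_lam_eq₃ (x y z : ℂ) :
    z + lam (x, y, z) = (csqrt x + csqrt z) * (csqrt y + csqrt z) := by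
  rw [lam]
  linear_combination -csqrt_sq z

/-- The path `t ↦ t + λ(t + x, t + y, t + z)`. The change of variable that it defines turns the
integrand of `RF` into itself, up to a factor `2`. -/
noncomputable def dupPath (x y z : ℂ) (t : ℝ) : ℂ := t + lam (t + x, t + y, t + z)

theorem kern_dupPath {x y z : ℂ} (h : Admissible x y z) {t : ℝ} (ht : 0 ≤ t) :
    (dupPath x y z t + x ∈ Complex.slitPlane ∧ dupPath x y z t + y ∈ Complex.slitPlane ∧
      dupPath x y z t + z ∈ Complex.slitPlane) ∧
    kern x y z (dupPath x y z t) = ((csqrt (t + x) + csqrt (t + y)) *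
      (csqrt (t + x) + csqrt (t + z)) * (csqrt (t + y) + csqrt (t + z)))⁻¹ := by
  obtain ⟨hx, hy, hz, hxy, hxz, hyz⟩ := h.add_ofReal ht
  have h1 := csqrt_add_csqrt_re_pos hx hy hxy
  have h2 := csqrt_add_csqrt_re_pos hx hz hxz
  have h3 := csqrt_add_csqrt_re_pos hy hz hyz
  have e1 : dupPath x y z t + x =
      (csqrt (t + x) + csqrt (t + y)) * (csqrt (t + x) + csqrt (t + z)) := by
    rw [dupPath, add_right_comm]
    exact add_lam_eq₁ (t + x) (t + y) (t + z)
  have e2 : dupPath x y z t + y =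
      (csqrt (t + x) + csqrt (t + y)) * (csqrt (t + y) + csqrt (t + z)) := by
    rw [dupPath, add_right_comm]
    exact add_lam_eq₂ (t + x) (t + y) (t + z)
  have e3 : dupPath x y z t + z =
      (csqrt (t + x) + csqrt (t + z)) * (csqrt (t + y) + csqrt (t + z)) := by
    rw [dupPath, add_right_comm]
    exact add_lam_eq₃ (t + x) (t + y) (t + z)
  refine ⟨⟨?_, ?_, ?_⟩, ?_⟩
  · rw [e1]; exact mul_mem_slitPlane h1 h2
  · rw [e2]; exact mul_mem_slitPlane h1 h3
  · rw [e3]; exact mul_mem_slitPlane h2 h3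
  · rw [kern, e1, e2, e3, csqrt_mul h1 h2, csqrt_mul h1 h3, csqrt_mul h2 h3]
    congr 1
    set a := csqrt (t + x) + csqrt (t + y)
    set b := csqrt (t + x) + csqrt (t + z)
    set c := csqrt (t + y) + csqrt (t + z)
    have ha := csqrt_sq a
    have hb := csqrt_sq b
    have hc := csqrt_sq c
    calc _ = csqrt a ^ 2 * csqrt b ^ 2 * csqrt c ^ 2 := by ring
      _ = _ := by rw [ha, hb, hc]

theorem hasDerivAt_dupPath {x y z : ℂ} (h : Admissible x y z) {t : ℝ} (ht : 0 < t) :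
    HasDerivAt (dupPath x y z) ((csqrt (t + x) + csqrt (t + y)) *
      (csqrt (t + x) + csqrt (t + z)) * (csqrt (t + y) + csqrt (t + z)) *
      (1 / 2 * kern x y z t)) t := by
  have hd : ∀ {v : ℂ}, v = 0 ∨ v ∈ Complex.slitPlane →
      csqrt (t + v) ≠ 0 ∧
      HasDerivAt (fun u : ℝ => csqrt (u + v)) (1 / (2 * csqrt (t + v))) t := fun {v} hv => by
    have hs := add_mem_slitPlane_of_eq_zero_or hv ht
    exact ⟨csqrt_ne_zero (Complex.slitPlane_ne_zero hs),
      ((hasDerivAt_csqrt hs).comp_add_const _ v).comp_ofReal⟩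
  obtain ⟨hx, hdx⟩ := hd h.1
  obtain ⟨hy, hdy⟩ := hd h.2.1
  obtain ⟨hz, hdz⟩ := hd h.2.2.1
  have hid : HasDerivAt (fun u : ℝ => (u : ℂ)) 1 t := Complex.ofRealCLM.hasDerivAt (x := t)
  have := hid.fun_add (((hdx.fun_mul hdy).fun_add (hdx.fun_mul hdz)).fun_add (hdy.fun_mul hdz))
  refine HasDerivAt.congr_deriv this ?_
  rw [kern]
  field_simp
  ring

theorem continuousWithinAt_dupPath {x y z : ℂ} (h : Admissible x y z) :
    ContinuousWithinAt (dupPath x y z) (Ici 0) 0 := by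
  have hc : ∀ {v : ℂ}, v = 0 ∨ v ∈ Complex.slitPlane →
      ContinuousAt (fun u : ℝ => csqrt (u + v)) 0 := fun {v} hv => by
    refine ContinuousAt.comp (f := fun u : ℝ => (u : ℂ) + v) (g := csqrt) ?_ (by fun_prop)
    simpa using continuousAt_csqrt hv
  have hx := hc h.1
  have hy := hc h.2.1
  have hz := hc h.2.2.1
  refine ContinuousAt.continuousWithinAt ?_
  exact (Complex.continuous_ofReal.continuousAt).add
    (((hx.mul hy).add (hx.mul hz)).add (hy.mul hz))

theorem dupPath_far (x y z : ℂ) :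
    ∀ᶠ t in atTop, ∀ u : ℝ, 0 ≤ u → 1 * (t + u) ≤ ‖dupPath x y z t + u‖ := by
  filter_upwards [eventually_gt_atTop ‖x‖, eventually_gt_atTop ‖y‖, eventually_gt_atTop ‖z‖]
    with t hx hy hz u _
  have hre : ∀ {v : ℂ}, ‖v‖ < t → 0 < (csqrt (t + v) ^ 2).re := fun {v} hv => by
    rw [csqrt_sq, Complex.add_re, Complex.ofReal_re]
    linarith [neg_abs_le v.re, Complex.abs_re_le_norm v]
  have hp : ∀ {v w : ℂ}, ‖v‖ < t → ‖w‖ < t → 0 < (csqrt (t + v) * csqrt (t + w)).re :=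
    fun hv hw => (mul_re_pos_of_sq_re_pos (csqrt_re_nonneg _) (csqrt_re_nonneg _)
      (hre hv) (hre hw)).1
  refine le_trans ?_ (Complex.re_le_norm _)
  have h1 := hp hx hy
  have h2 := hp hx hz
  have h3 := hp hy hz
  rw [dupPath, lam, Complex.add_re, Complex.add_re, Complex.add_re, Complex.add_re,
    Complex.ofReal_re, Complex.ofReal_re]
  linarith

/-- The substitution `s = t + λ(t + x, t + y, t + z)`: along `dupPath`, the integrand of the tail
integral starting at `λ` pulls back to half the integrand of `RF`. -/
theorem RF_eq_kernTail_lam {x y z : ℂ} (h : Admissible x y z) :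
    RF x y z = kernTail x y z (lam (x, y, z)) := by
  have hk : ∀ t : ℝ, 0 < t → kern x y z (dupPath x y z t) *
      ((csqrt (t + x) + csqrt (t + y)) * (csqrt (t + x) + csqrt (t + z)) *
        (csqrt (t + y) + csqrt (t + z)) * (1 / 2 * kern x y z t)) = 1 / 2 * kern x y z t :=
    fun t ht => by
      obtain ⟨hx, hy, hz, hxy, hxz, hyz⟩ := h.add_ofReal ht.le
      have hne : ∀ {s : ℂ}, 0 < s.re → s ≠ 0 := fun hs h0 => by simp [h0] at hs
      have h1 := hne (csqrt_add_csqrt_re_pos hx hy hxy)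
      have h2 := hne (csqrt_add_csqrt_re_pos hx hz hxz)
      have h3 := hne (csqrt_add_csqrt_re_pos hy hz hyz)
      rw [(kern_dupPath h ht.le).2]
      field_simp
  have hint := IntegrableOn.congr_fun (h.integrableOn_kern.const_mul (1 / 2))
    (fun t ht => (hk t ht).symm) measurableSet_Ioi
  have := kernTail_eq_integral one_pos (dupPath_far x y z) (continuousWithinAt_dupPath h)
    (fun t ht => hasDerivAt_dupPath h ht) (fun t ht => (kern_dupPath h ht).1.1)
    (fun t ht => (kern_dupPath h ht).1.2.1) (fun t ht => (kern_dupPath h ht).1.2.2) hint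
  rw [setIntegral_congr_fun measurableSet_Ioi hk, integral_const_mul, ← RF_eq_kern] at this
  rw [← this]
  simp [dupPath]

theorem Admissible.add_lam_mem_slitPlane {x y z : ℂ} (h : Admissible x y z) :
    x + lam (x, y, z) ∈ Complex.slitPlane ∧ y + lam (x, y, z) ∈ Complex.slitPlane ∧
      z + lam (x, y, z) ∈ Complex.slitPlane := by
  have := (kern_dupPath h le_rfl).1
  simpa [dupPath, add_comm] using this

theorem div_four_mem_slitPlane {v : ℂ} (hv : v ∈ Complex.slitPlane) :
    v / 4 ∈ Complex.slitPlane := by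
  have := ofReal_mul_mem_slitPlane (k := 1 / 4) (by norm_num) hv
  convert this using 1
  push_cast
  ring

/-- The duplication theorem: `RF` is invariant under one step of the iteration. It combines the
substitution of `RF_eq_kernTail_lam` with the homogeneity of `RF` under division by `4`. -/
theorem RF_duplication {x y z : ℂ} (h : Admissible x y z) :
    RF x y z = RF ((x + lam (x, y, z)) / 4) ((y + lam (x, y, z)) / 4)
      ((z + lam (x, y, z)) / 4) := by
  obtain ⟨hx, hy, hz⟩ := h.add_lam_mem_slitPlane
  have h4 : ∀ v : ℂ, v / 4 ∈ Complex.slitPlane → ∀ t : ℝ, 0 ≤ t →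
      (4 : ℂ) * (t + v / 4) ∈ Complex.slitPlane ∧
      csqrt (4 * (t + v / 4)) = csqrt 4 * csqrt (t + v / 4) := fun v hv t ht => by
    have hs := add_ofReal_mem_slitPlane hv ht
    rw [add_comm] at hs
    exact ⟨by simpa using ofReal_mul_mem_slitPlane (k := 4) (by norm_num) hs,
      by simpa using csqrt_mul_ofReal (k := 4) (by norm_num) hs⟩
  have hx4 := div_four_mem_slitPlane hx
  have hy4 := div_four_mem_slitPlane hy
  have hz4 := div_four_mem_slitPlane hz
  have hm := RF_mul (A := 4) (by simp) hx4 hy4 hz4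
    (h4 _ hx4) (h4 _ hy4) (h4 _ hz4)
  have e : ∀ v : ℂ, 4 * (v / 4) = v := fun v => by ring
  have hs : csqrt 4 = 2 := by
    symm
    exact eq_csqrt_of_sq_eq (by norm_num) (by norm_num)
  have ha := RF_add x y z (lam (x, y, z))
  rw [e, e, e, hs, add_comm x, add_comm y, add_comm z, ha] at hm
  rw [RF_eq_kernTail_lam h, add_comm x, add_comm y, add_comm z]
  linear_combination 2 * hm

/-! ### The iterates stay in the cut plane -/

/-- The case where `t₂` lies between `t₁` and `t₃`: then `t₁ t₃ ≤ t₂ (t₁ + t₃ - t₂)`, and the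
relation bounds the sum by `-(c₁ + c₂ + c₃) t₂²`. -/
theorem weighted_products_nonpos_of_median {c₁ c₂ c₃ t₁ t₂ t₃ : ℝ} (h₁ : 0 ≤ c₁) (h₂ : 0 ≤ c₂)
    (h₃ : 0 ≤ c₃) (h0 : c₁ * (t₂ + t₃) + c₂ * (t₁ + t₃) + c₃ * (t₁ + t₂) = 0)
    (hm : (t₁ - t₂) * (t₃ - t₂) ≤ 0) : c₁ * (t₂ * t₃) + c₂ * (t₁ * t₃) + c₃ * (t₁ * t₂) ≤ 0 := by
  have h4 : c₂ * ((t₁ - t₂) * (t₃ - t₂)) ≤ 0 := mul_nonpos_of_nonneg_of_nonpos h₂ hm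
  have h5 : 0 ≤ (c₁ + c₂ + c₃) * t₂ ^ 2 := by positivity
  linear_combination h4 + t₂ * h0 + h5

theorem weighted_products_nonpos {c₁ c₂ c₃ t₁ t₂ t₃ : ℝ} (h₁ : 0 ≤ c₁) (h₂ : 0 ≤ c₂)
    (h₃ : 0 ≤ c₃) (h0 : c₁ * (t₂ + t₃) + c₂ * (t₁ + t₃) + c₃ * (t₁ + t₂) = 0) :
    c₁ * (t₂ * t₃) + c₂ * (t₁ * t₃) + c₃ * (t₁ * t₂) ≤ 0 := by
  -- one of the three numbers lies between the other two
  have hmed : (t₁ - t₂) * (t₃ - t₂) ≤ 0 ∨ (t₂ - t₁) * (t₃ - t₁) ≤ 0 ∨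
      (t₁ - t₃) * (t₂ - t₃) ≤ 0 := by
    rcases le_total t₁ t₂ with h12 | h12 <;> rcases le_total t₂ t₃ with h23 | h23 <;>
      rcases le_total t₁ t₃ with h13 | h13
    · left; nlinarith
    · left; nlinarith
    · right; right; nlinarith
    · right; left; nlinarith
    · right; left; nlinarith
    · right; right; nlinarith
    · left; nlinarith
    · left; nlinarith
  rcases hmed with h | h | h
  · exact weighted_products_nonpos_of_median h₁ h₂ h₃ h0 h
  · have := weighted_products_nonpos_of_median (t₁ := t₂) (t₂ := t₁) (t₃ := t₃) h₂ h₁ h₃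
      (by linarith) h
    linarith
  · have := weighted_products_nonpos_of_median (t₁ := t₁) (t₂ := t₃) (t₃ := t₂) h₁ h₃ h₂
      (by linarith) h
    linarith

/-- With `u_i` in the right half plane, a weighted sum of the products `u_j u_k` equals
`u₁ u₂ u₃ ∑ w_i / u_i`, whose phase lies between the sum of the two smallest and the sum of the two
largest phases of the `u_i`. In terms of the slopes `t_i = im u_i / re u_i`,
`weighted_products_nonpos` makes the real part positive where the imaginary part vanishes. -/
theorem combination_mem_slitPlane {u₁ u₂ u₃ : ℂ} (hu₁ : 0 < u₁.re) (hu₂ : 0 < u₂.re)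
    (hu₃ : 0 < u₃.re) {w₁ w₂ w₃ : ℝ} (h₁ : 0 ≤ w₁) (h₂ : 0 ≤ w₂) (h₃ : 0 ≤ w₃)
    (hw : 0 < w₁ + w₂ + w₃) :
    w₁ * (u₂ * u₃) + w₂ * (u₁ * u₃) + w₃ * (u₁ * u₂) ∈ Complex.slitPlane := by
  obtain ⟨p₁, q₁⟩ := u₁
  obtain ⟨p₂, q₂⟩ := u₂
  obtain ⟨p₃, q₃⟩ := u₃
  simp only at hu₁ hu₂ hu₃
  obtain ⟨t₁, rfl⟩ : ∃ t, q₁ = p₁ * t := ⟨q₁ / p₁, by field_simp⟩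
  obtain ⟨t₂, rfl⟩ : ∃ t, q₂ = p₂ * t := ⟨q₂ / p₂, by field_simp⟩
  obtain ⟨t₃, rfl⟩ : ∃ t, q₃ = p₃ * t := ⟨q₃ / p₃, by field_simp⟩
  rw [Complex.mem_slitPlane_iff]
  simp only [Complex.add_re, Complex.add_im, Complex.mul_re, Complex.mul_im,
    Complex.ofReal_re, Complex.ofReal_im, zero_mul, sub_zero, add_zero]
  have hc₁ : 0 ≤ w₁ * (p₂ * p₃) := by positivity
  have hc₂ : 0 ≤ w₂ * (p₁ * p₃) := by positivity
  have hc₃ : 0 ≤ w₃ * (p₁ * p₂) := by positivity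
  have hpos : 0 < w₁ * (p₂ * p₃) + w₂ * (p₁ * p₃) + w₃ * (p₁ * p₂) := by
    by_contra hle
    have e₁ : w₁ * (p₂ * p₃) = 0 := by linarith
    have e₂ : w₂ * (p₁ * p₃) = 0 := by linarith
    have e₃ : w₃ * (p₁ * p₂) = 0 := by linarith
    simp only [mul_eq_zero, hu₁.ne', hu₂.ne', hu₃.ne', or_false] at e₁ e₂ e₃
    linarith
  by_contra hcon
  push Not at hcon
  obtain ⟨hre, him⟩ := hcon
  have := weighted_products_nonpos hc₁ hc₂ hc₃ (t₁ := t₁) (t₂ := t₂) (t₃ := t₃)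
    (by linear_combination him)
  linarith

theorem iter_succ_eq (x y z : ℂ) (n : ℕ) : iter x y z (n + 1) =
    (((iter x y z n).1 + lam (iter x y z n)) / 4, ((iter x y z n).2.1 + lam (iter x y z n)) / 4,
      ((iter x y z n).2.2 + lam (iter x y z n)) / 4) := rfl

theorem Admissible.admissible_iter {x y z : ℂ} (h : Admissible x y z) (n : ℕ) :
    Admissible (iter x y z n).1 (iter x y z n).2.1 (iter x y z n).2.2 := by
  induction n with
  | zero => exact h
  | succ n ih =>
    obtain ⟨hx, hy, hz⟩ := ih.add_lam_mem_slitPlane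
    exact .of_mem_slitPlane (div_four_mem_slitPlane hx) (div_four_mem_slitPlane hy)
      (div_four_mem_slitPlane hz)

theorem RF_iter {x y z : ℂ} (h : Admissible x y z) (n : ℕ) :
    RF x y z = RF (iter x y z n).1 (iter x y z n).2.1 (iter x y z n).2.2 := by
  induction n with
  | zero => rfl
  | succ n ih => rw [ih, RF_duplication (h.admissible_iter n), iter_succ_eq]

theorem A_eq_mean (x y z : ℂ) (n : ℕ) :
    A x y z n = ((iter x y z n).1 + (iter x y z n).2.1 + (iter x y z n).2.2) / 3 := by
  induction n with
  | zero => rfl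
  | succ n ih =>
    rw [A, ih, iter_succ_eq]
    ring

theorem A_sub_iter (x y z : ℂ) (n : ℕ) :
    A x y z n - (iter x y z n).1 = (A x y z 0 - x) / 4 ^ n ∧
    A x y z n - (iter x y z n).2.1 = (A x y z 0 - y) / 4 ^ n ∧
    A x y z n - (iter x y z n).2.2 = (A x y z 0 - z) / 4 ^ n := by
  induction n with
  | zero => simp [iter]
  | succ n ih =>
    have hA : A x y z (n + 1) = (A x y z n + lam (iter x y z n)) / 4 := rfl
    rw [hA, iter_succ_eq]
    refine ⟨?_, ?_, ?_⟩
    · rw [pow_succ, ← div_div, ← ih.1]; ring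
    · rw [pow_succ, ← div_div, ← ih.2.1]; ring
    · rw [pow_succ, ← div_div, ← ih.2.2]; ring

/-! ### The stopping criterion is met -/

/-- With `s_i` the square roots, the new arguments are products of two of the means
`(s_i + s_j) / 2`, and `re_mul_csqrt_ge` applies to these. -/
theorem le_re_csqrt_dup {a b c : ℂ} {m : ℝ} (hm : 0 < m) (hab : 2 * m ≤ (csqrt a + csqrt b).re)
    (hac : 2 * m ≤ (csqrt a + csqrt c).re) (hbc : 2 * m ≤ (csqrt b + csqrt c).re) :
    m ≤ (csqrt ((a + lam (a, b, c)) / 4)).re ∧ m ≤ (csqrt ((b + lam (a, b, c)) / 4)).re ∧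
      m ≤ (csqrt ((c + lam (a, b, c)) / 4)).re := by
  have h2 : ∀ {s : ℂ}, 2 * m ≤ s.re → m ≤ (s / 2).re := fun {s} hs => by
    have : (s / 2).re = s.re / 2 := by simp
    rw [this]
    linarith
  have e : ∀ u v : ℂ, u * v / 4 = u / 2 * (v / 2) := fun u v => by ring
  rw [add_lam_eq₁, add_lam_eq₂, add_lam_eq₃, e, e, e]
  exact ⟨re_mul_csqrt_ge hm (h2 hab) (h2 hac), re_mul_csqrt_ge hm (h2 hab) (h2 hbc),
    re_mul_csqrt_ge hm (h2 hac) (h2 hbc)⟩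

/-- The real parts of the square roots of the iterates are bounded away from `0`: a common lower
bound is inherited from one step to the next. -/
theorem exists_le_re_csqrt_iter {x y z : ℂ} (h : Admissible x y z) :
    ∃ m : ℝ, 0 < m ∧ ∀ n : ℕ, m ≤ (csqrt (iter x y z (n + 1)).1).re ∧
      m ≤ (csqrt (iter x y z (n + 1)).2.1).re ∧ m ≤ (csqrt (iter x y z (n + 1)).2.2).re := by
  obtain ⟨hx, hy, hz, hxy, hxz, hyz⟩ := h
  have h1 := csqrt_add_csqrt_re_pos hx hy hxy
  have h2 := csqrt_add_csqrt_re_pos hx hz hxz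
  have h3 := csqrt_add_csqrt_re_pos hy hz hyz
  obtain ⟨m, hm, hm1, hm2, hm3⟩ : ∃ m : ℝ, 0 < m ∧ 2 * m ≤ (csqrt x + csqrt y).re ∧
      2 * m ≤ (csqrt x + csqrt z).re ∧ 2 * m ≤ (csqrt y + csqrt z).re := by
    refine ⟨min (csqrt x + csqrt y).re (min (csqrt x + csqrt z).re (csqrt y + csqrt z).re) / 2,
      by positivity, ?_, ?_, ?_⟩ <;> rw [mul_div_cancel₀ _ two_ne_zero]
    · exact min_le_left _ _
    · exact (min_le_right _ _).trans (min_le_left _ _)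
    · exact (min_le_right _ _).trans (min_le_right _ _)
  refine ⟨m, hm, fun n => ?_⟩
  induction n with
  | zero => exact le_re_csqrt_dup hm hm1 hm2 hm3
  | succ n ih =>
    obtain ⟨i1, i2, i3⟩ := ih
    refine le_re_csqrt_dup (a := (iter x y z (n + 1)).1)
      (b := (iter x y z (n + 1)).2.1) (c := (iter x y z (n + 1)).2.2)
      hm ?_ ?_ ?_ <;> rw [Complex.add_re] <;> linarith

theorem exists_stop (r : ℝ) {x y z : ℂ} (h : Admissible x y z) :
    ∃ n : ℕ, 1 ≤ n ∧ Stop r x y z n := by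
  obtain ⟨m, hm, hmn⟩ := exists_le_re_csqrt_iter h
  have hm2 : 0 < m ^ 2 := by positivity
  have hlim : Tendsto (fun n : ℕ => (Q r x y z + ‖A x y z 0 - x‖) / (4 : ℝ) ^ (n + 1)) atTop
      (𝓝 0) :=
    (tendsto_const_nhds.div_atTop (tendsto_pow_atTop_atTop_of_one_lt (by norm_num))).comp
      (tendsto_add_atTop_nat 1)
  obtain ⟨n, hn⟩ := (hlim.eventually_lt_const hm2).exists
  refine ⟨n + 1, by omega, ?_⟩
  have h1 : m ^ 2 ≤ ‖(iter x y z (n + 1)).1‖ := by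
    rw [← norm_csqrt_sq]
    gcongr
    exact (hmn n).1.trans (Complex.re_le_norm _)
  have h2 : ‖A x y z (n + 1) - (iter x y z (n + 1)).1‖ = ‖A x y z 0 - x‖ / 4 ^ (n + 1) := by
    rw [(A_sub_iter x y z (n + 1)).1, norm_div, norm_pow]
    norm_num
  have h3 := norm_le_norm_add_norm_sub (A x y z (n + 1)) (iter x y z (n + 1)).1
  rw [add_div] at hn
  rw [Stop]
  linarith

/-! ### Normalization by the mean -/

/-- No convex combination of `x, y, z` is a negative real number. The combinations are written out,
so that the condition can be checked directly for the iterates. -/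
def HullCondition (x y z : ℂ) : Prop :=
  ∀ w₁ w₂ w₃ : ℝ, 0 ≤ w₁ → 0 ≤ w₂ → 0 ≤ w₃ → w₁ + w₂ + w₃ = 1 →
    w₁ * x + w₂ * y + w₃ * z ∈ insert 0 Complex.slitPlane

theorem hullCondition_of_convexHull_subset {x y z : ℂ}
    (h : convexHull ℝ {x, y, z} ⊆ insert 0 Complex.slitPlane) : HullCondition x y z := by
  intro w₁ w₂ w₃ h₁ h₂ h₃ hw
  apply h
  have hsub := subset_convexHull ℝ ({x, y, z} : Set ℂ)
  have := (convex_convexHull ℝ ({x, y, z} : Set ℂ)).sum_mem (t := Finset.univ)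
    (w := ![w₁, w₂, w₃]) (z := ![x, y, z])
    (by simp [Fin.forall_fin_succ, h₁, h₂, h₃])
    (by simpa [Fin.sum_univ_three] using hw)
    (by
      simp only [Finset.mem_univ, forall_const, Fin.forall_fin_succ]
      exact ⟨hsub (by simp), hsub (by simp), hsub (by simp), fun i => i.elim0⟩)
  simpa [Fin.sum_univ_three] using this

theorem Admissible.hullCondition_iter_succ {x y z : ℂ} (h : Admissible x y z) (n : ℕ) :
    HullCondition (iter x y z (n + 1)).1 (iter x y z (n + 1)).2.1
      (iter x y z (n + 1)).2.2 := by
  intro w₁ w₂ w₃ h₁ h₂ h₃ hw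
  right
  obtain ⟨hx, hy, hz, hxy, hxz, hyz⟩ := h.admissible_iter n
  have := combination_mem_slitPlane (csqrt_add_csqrt_re_pos hy hz hyz)
    (csqrt_add_csqrt_re_pos hx hz hxz) (csqrt_add_csqrt_re_pos hx hy hxy) h₁ h₂ h₃ (by linarith)
  have h4 := div_four_mem_slitPlane this
  rw [iter_succ_eq]
  convert h4 using 1
  simp only [show lam (iter x y z n) = lam ((iter x y z n).1,
    (iter x y z n).2.1, (iter x y z n).2.2) from rfl, add_lam_eq₁, add_lam_eq₂,
    add_lam_eq₃]
  ring

theorem HullCondition.perm₁₂ {x y z : ℂ} (h : HullCondition x y z) : HullCondition y x z :=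
  fun w₁ w₂ w₃ h₁ h₂ h₃ hw => by
    have := h w₂ w₁ w₃ h₂ h₁ h₃ (by linarith)
    rwa [add_comm (w₂ * x : ℂ)] at this

theorem HullCondition.perm₁₃ {x y z : ℂ} (h : HullCondition x y z) : HullCondition z y x :=
  fun w₁ w₂ w₃ h₁ h₂ h₃ hw => by
    have := h w₃ w₂ w₁ h₃ h₂ h₁ (by linarith)
    convert this using 1
    ring

theorem one_sub_mul_re_pos {V : ℂ} (hV : ‖V‖ < 1) {s : ℝ} (hs : s ∈ Icc (0 : ℝ) 1) :
    0 < (1 - s * V).re := by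
  rw [Complex.sub_re, Complex.one_re, Complex.re_ofReal_mul]
  have h1 := (Complex.re_le_norm V).trans_lt hV
  rcases hs.1.eq_or_lt with h | h
  · simp [← h]
  · linarith [mul_lt_of_lt_one_right h h1, hs.2]

/-- Along a segment starting at `A` that avoids the cut, the principal square root of `A v` is the
product of those of `A` and `v`: the real part of that product cannot vanish, so it keeps the
sign it has at the start. -/
theorem csqrt_mul_of_segment {A V : ℂ} (hV : ‖V‖ < 1)
    (h : ∀ s ∈ Icc (0 : ℝ) 1, A * (1 - s * V) ∈ Complex.slitPlane) {s : ℝ}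
    (hs : s ∈ Icc (0 : ℝ) 1) :
    csqrt (A * (1 - s * V)) = csqrt A * csqrt (1 - s * V) := by
  have hA : A ∈ Complex.slitPlane := by simpa using h 0 (by simp)
  have hsq : ∀ t : ℝ, (csqrt A * csqrt (1 - t * V)) ^ 2 = A * (1 - t * V) := fun t => by
    rw [mul_pow, csqrt_sq, csqrt_sq]
  set φ : ℝ → ℝ := fun t => (csqrt A * csqrt (1 - t * V)).re with hφ
  have hcont : ContinuousOn φ (Icc 0 1) := fun t ht => by
    have h1 : ContinuousAt csqrt (1 - (t : ℂ) * V) :=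
      continuousAt_csqrt (.inr (Complex.mem_slitPlane_iff.2 (.inl (one_sub_mul_re_pos hV ht))))
    have h2 : ContinuousAt (fun t : ℝ => csqrt (1 - (t : ℂ) * V)) t :=
      ContinuousAt.comp (f := fun t : ℝ => 1 - (t : ℂ) * V) h1 (by fun_prop)
    exact (Complex.continuous_re.continuousAt.comp (h2.const_mul _)).continuousWithinAt
  have hne : ∀ t ∈ Icc (0 : ℝ) 1, φ t ≠ 0 := fun t ht h0 => by
    apply sq_notMem_slitPlane_of_re_eq_zero h0
    rw [hsq]
    exact h t ht
  have hone : csqrt 1 = 1 := (eq_csqrt_of_sq_eq (by simp) (by simp)).symm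
  have h0 : 0 < φ 0 := by simpa [hφ, hone] using csqrt_re_pos hA
  have hpos : 0 < φ s := by
    by_contra hle
    push Not at hle
    obtain ⟨t, ht, ht0⟩ := intermediate_value_Icc' hs.1 (hcont.mono (Icc_subset_Icc_right hs.2))
      (⟨hle, h0.le⟩ : (0 : ℝ) ∈ Icc (φ s) (φ 0))
    exact hne t ⟨ht.1, ht.2.trans hs.2⟩ ht0
  exact (eq_csqrt_of_sq_eq hpos (hsq s)).symm

theorem HullCondition.segment {x y z a V : ℂ} (h : HullCondition x y z) (ha : a ≠ 0)
    (hV : ‖V‖ < 1) (hmean : a = (x + y + z) / 3) (hx : x = a * (1 - V)) :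
    ∀ s ∈ Icc (0 : ℝ) 1, a * (1 - s * V) ∈ Complex.slitPlane := fun s hs => by
  have := h ((1 - s) / 3 + s) ((1 - s) / 3) ((1 - s) / 3) (by linarith [hs.1, hs.2])
    (by linarith [hs.2]) (by linarith [hs.2]) (by ring)
  have e : (((1 - s) / 3 + s : ℝ) : ℂ) * x + ((1 - s) / 3 : ℝ) * y + ((1 - s) / 3 : ℝ) * z =
      a * (1 - s * V) := by
    push_cast
    linear_combination (s - 1) * hmean + s * hx
  rw [e] at this
  refine (mem_insert_iff.1 this).resolve_left (mul_ne_zero ha fun h0 => ?_)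
  have := one_sub_mul_re_pos hV hs
  rw [h0] at this
  simp at this

theorem mul_add_of_segment {a V : ℂ} (hV : ‖V‖ < 1)
    (h : ∀ s ∈ Icc (0 : ℝ) 1, a * (1 - s * V) ∈ Complex.slitPlane) {t : ℝ} (ht : 0 ≤ t) :
    a * (t + (1 - V)) ∈ Complex.slitPlane ∧
      csqrt (a * (t + (1 - V))) = csqrt a * csqrt (t + (1 - V)) := by
  have ht1 : 0 < t + 1 := by linarith
  have hs : (t + 1)⁻¹ ∈ Icc (0 : ℝ) 1 := ⟨by positivity, inv_le_one_of_one_le₀ (by linarith)⟩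
  have hne : (t : ℂ) + 1 ≠ 0 := by exact_mod_cast ht1.ne'
  have e : (t : ℂ) + (1 - V) = ((t + 1 : ℝ) : ℂ) * (1 - ((t + 1)⁻¹ : ℝ) * V) := by
    push_cast
    field_simp
    ring
  have hslit : 1 - (((t + 1)⁻¹ : ℝ) : ℂ) * V ∈ Complex.slitPlane :=
    Complex.mem_slitPlane_iff.2 (.inl (one_sub_mul_re_pos hV hs))
  rw [e, mul_left_comm, csqrt_mul_ofReal ht1 (h _ hs), csqrt_mul_of_segment hV h hs,
    csqrt_mul_ofReal ht1 hslit]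
  exact ⟨ofReal_mul_mem_slitPlane ht1 (h _ hs), by ring⟩

theorem HullCondition.RF_eq {x y z a U V W : ℂ} (h : HullCondition x y z) (ha : a ≠ 0)
    (hU : ‖U‖ < 1) (hV : ‖V‖ < 1) (hW : ‖W‖ < 1) (hmean : a = (x + y + z) / 3)
    (hx : x = a * (1 - U)) (hy : y = a * (1 - V)) (hz : z = a * (1 - W)) :
    RF x y z = (csqrt a)⁻¹ * RF (1 - U) (1 - V) (1 - W) := by
  have sx := h.segment ha hU hmean hx
  have sy := h.perm₁₂.segment ha hV (by rw [hmean]; ring) hy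
  have sz := h.perm₁₃.segment ha hW (by rw [hmean]; ring) hz
  have hA : a ∈ Complex.slitPlane := by simpa using sx 0 (by simp)
  rw [hx, hy, hz]
  exact RF_mul hA (one_sub_mem_slitPlane hU) (one_sub_mem_slitPlane hV) (one_sub_mem_slitPlane hW)
    (fun t ht => mul_add_of_segment hU sx ht) (fun t ht => mul_add_of_segment hV sy ht)
    (fun t ht => mul_add_of_segment hW sz ht)

/-! ### The truncated expansion near equal arguments -/

theorem one_le_norm_add_one {s : ℂ} {b : ℝ} (hs : b ≤ s.re) : 1 + b ≤ ‖s + 1‖ := by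
  refine le_trans ?_ (Complex.re_le_norm _)
  rw [Complex.add_re, Complex.one_re]
  linarith

theorem one_sub_norm_sub_one_le_re (s : ℂ) : 1 - ‖s - 1‖ ≤ s.re := by
  have := (abs_le.1 (Complex.abs_re_le_norm (s - 1))).1
  rw [Complex.sub_re, Complex.one_re] at this
  linarith

theorem norm_csqrt_one_sub_sub_one_le {U : ℂ} (hU : ‖U‖ ≤ 0.311) :
    ‖csqrt (1 - U) - 1‖ ≤ 0.185 := by
  have hs0 := csqrt_re_nonneg (1 - U)
  have hsq := csqrt_sq (1 - U)
  set s := csqrt (1 - U)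
  have hprod : ‖s - 1‖ * ‖s + 1‖ ≤ 0.311 := by
    rw [← norm_mul, show (s - 1) * (s + 1) = -U by linear_combination hsq, norm_neg]
    exact hU
  -- the trivial bound `0 ≤ re s`, used twice
  have h1 := one_le_norm_add_one hs0
  have h2 : ‖s - 1‖ ≤ 0.311 := by nlinarith [norm_nonneg (s - 1)]
  have h3 := one_le_norm_add_one (one_sub_norm_sub_one_le_re s)
  have h4 : 1.689 ≤ ‖s + 1‖ := by linarith
  nlinarith [norm_nonneg (s - 1)]

theorem re_csqrt_mul₃_pos {U V W : ℂ} (hU : ‖U‖ ≤ 0.311) (hV : ‖V‖ ≤ 0.311)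
    (hW : ‖W‖ ≤ 0.311) : 0 < (csqrt (1 - U) * csqrt (1 - V) * csqrt (1 - W)).re := by
  have hab : ∀ {a b : ℂ}, ‖(a + 1) * (b + 1) - 1‖ ≤ ‖a‖ * ‖b‖ + ‖a‖ + ‖b‖ := fun {a b} => by
    rw [show (a + 1) * (b + 1) - 1 = a * b + a + b by ring, ← norm_mul]
    exact norm_add₃_le
  have ha := norm_csqrt_one_sub_sub_one_le hU
  have hb := norm_csqrt_one_sub_sub_one_le hV
  have hc := norm_csqrt_one_sub_sub_one_le hW
  have h1 := hab (a := csqrt (1 - U) - 1) (b := csqrt (1 - V) - 1)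
  rw [sub_add_cancel, sub_add_cancel] at h1
  have h2 := hab (a := csqrt (1 - U) * csqrt (1 - V) - 1) (b := csqrt (1 - W) - 1)
  rw [sub_add_cancel, sub_add_cancel] at h2
  refine lt_of_lt_of_le ?_ (one_sub_norm_sub_one_le_re _)
  have h3 : ‖csqrt (1 - U) - 1‖ * ‖csqrt (1 - V) - 1‖ ≤ 0.185 * 0.185 := by gcongr
  have h4 : ‖csqrt (1 - U) * csqrt (1 - V) - 1‖ ≤ 0.405 := by linarith
  have h5 : ‖csqrt (1 - U) * csqrt (1 - V) - 1‖ * ‖csqrt (1 - W) - 1‖ ≤ 0.405 * 0.185 := by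
    gcongr
  linarith

/-- The remainder of the expansion of `(1 + w)^{-1/2}` to second order, for any square root `s` of
`1 + w` in the right half plane. With `T` the quadratic polynomial and `q = s⁻¹`, it is
`-(T² - q²) / (T + q)`, and `T² - q² = q² (T² (1 + w) - 1)` is divisible by `w³`. -/
theorem norm_inv_sub_quadratic_le {s w : ℂ} (hs : 0 < s.re) (hsw : s ^ 2 = 1 + w)
    (hw : ‖w‖ ≤ 0.1752) :
    ‖s⁻¹ - (1 - w / 2 + 3 / 8 * w ^ 2)‖ ≤ 0.485 * ‖w‖ ^ 3 := by
  have hs0 : s ≠ 0 := fun h => by simp [h] at hs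
  have hq0 : 0 ≤ (s⁻¹).re := by
    rw [Complex.inv_re]
    exact div_nonneg hs.le (Complex.normSq_nonneg s)
  have hq2 : (s⁻¹) ^ 2 * (1 + w) = 1 := by
    rw [← hsw]
    field_simp
  set q := s⁻¹
  have h1w : 0.8248 ≤ ‖1 + w‖ := by
    have := norm_sub_le_norm_add 1 w
    rw [norm_one] at this
    linarith
  have hqn : ‖q ^ 2‖ ≤ 1.2125 := by
    have : ‖q ^ 2‖ * ‖1 + w‖ = 1 := by rw [← norm_mul, hq2, norm_one]
    nlinarith [norm_nonneg (q ^ 2)]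
  have hqre : 0.787 ≤ q.re := by
    have h1 : ‖q - 1‖ * ‖q + 1‖ ≤ 1.2125 * 0.1752 := by
      rw [← norm_mul, show (q - 1) * (q + 1) = -(q ^ 2 * w) by linear_combination hq2, norm_neg,
        norm_mul]
      gcongr
    have h2 := one_le_norm_add_one hq0
    -- `|q - 1| |q + 1| = |q² w|`, and `1 ≤ |q + 1|`
    have h3 : ‖q - 1‖ ≤ 0.213 := by nlinarith [norm_nonneg (q - 1)]
    linarith [one_sub_norm_sub_one_le_re q]
  set T := 1 - w / 2 + 3 / 8 * w ^ 2 with hT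
  have hw2 : ‖w‖ ^ 2 ≤ 0.0307 := by nlinarith [norm_nonneg w]
  have hTre : 0.9 ≤ T.re := by
    have h1 : ‖T - 1‖ ≤ ‖w‖ / 2 + 3 / 8 * ‖w‖ ^ 2 := by
      rw [hT, show 1 - w / 2 + 3 / 8 * w ^ 2 - 1 = -(w / 2) + 3 / 8 * w ^ 2 by ring]
      refine (norm_add_le _ _).trans (le_of_eq ?_)
      simp
    linarith [one_sub_norm_sub_one_le_re T]
  have hsum : 1.687 ≤ ‖q + T‖ := by
    refine le_trans ?_ (Complex.re_le_norm _)
    rw [Complex.add_re]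
    linarith
  have hfac : ‖5 / 8 - 15 / 64 * w + 9 / 64 * w ^ 2‖ ≤ 0.671 := by
    refine (norm_add_le _ _).trans ?_
    refine (add_le_add_left (norm_sub_le _ _) _).trans ?_
    simp only [norm_mul, norm_div, norm_pow, Complex.norm_ofNat]
    linarith
  have hkey : ‖q - T‖ * ‖q + T‖ ≤ 1.2125 * (‖w‖ ^ 3 * 0.671) := by
    rw [← norm_mul, show (q - T) * (q + T) =
      -(q ^ 2 * (w ^ 3 * (5 / 8 - 15 / 64 * w + 9 / 64 * w ^ 2))) by
        rw [hT]
        linear_combination (1 - w / 2 + 3 / 8 * w ^ 2) ^ 2 * hq2, norm_neg, norm_mul, norm_mul,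
      norm_pow w]
    gcongr
  have : 0 ≤ ‖w‖ ^ 3 := by positivity
  nlinarith [norm_nonneg (q - T)]

/-- Since `U + V + W = 0`, the expression is `-(U² + V² + W²) / 2`. -/
theorem norm_E₂_le {U V W : ℂ} {e : ℝ} (hU : ‖U‖ ≤ e) (hV : ‖V‖ ≤ e) (hW : ‖W‖ ≤ e)
    (h0 : W = -U - V) : ‖U * V - W ^ 2‖ ≤ 3 / 2 * e ^ 2 := by
  have h1 : U * V - W ^ 2 = -(1 / 2) * (U ^ 2 + V ^ 2 + W ^ 2) := by
    rw [h0]; ring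
  have hsq : ∀ {v : ℂ}, ‖v‖ ≤ e → ‖v ^ 2‖ ≤ e ^ 2 := fun h => by
    rw [norm_pow]; gcongr
  have h2 := norm_add₃_le (a := U ^ 2) (b := V ^ 2) (c := W ^ 2)
  rw [h1, norm_mul]
  have h3 : ‖(-(1 / 2) : ℂ)‖ = 1 / 2 := by norm_num
  rw [h3]
  linarith [hsq hU, hsq hV, hsq hW]

theorem norm_E₃_le {U V W : ℂ} {e : ℝ} (hU : ‖U‖ ≤ e) (hV : ‖V‖ ≤ e) (hW : ‖W‖ ≤ e) :
    ‖U * V * W‖ ≤ e ^ 3 := by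
  have := (norm_nonneg U).trans hU
  rw [norm_mul, norm_mul, show e ^ 3 = e * e * e by ring]
  gcongr

/-- The square of the product of the three roots is `1 + w` with `w = E₂ - E₃`. The polynomial is
the quadratic expansion of `(1 + w)^{-1/2}` without the term `3 / 8 * E₃ ^ 2`, which joins the
error. -/
theorem norm_prod_sub_le {U V W : ℂ} {e : ℝ} (hU : ‖U‖ ≤ e) (hV : ‖V‖ ≤ e) (hW : ‖W‖ ≤ e)
    (he : e ≤ 0.311) (h0 : W = -U - V) :
    ‖(csqrt (1 - U) * csqrt (1 - V) * csqrt (1 - W))⁻¹ -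
      (1 - (U * V - W ^ 2) / 2 + U * V * W / 2 + 3 / 8 * (U * V - W ^ 2) ^ 2 -
        3 / 4 * ((U * V - W ^ 2) * (U * V * W)))‖ ≤ 3.3 * e ^ 6 := by
  have he0 : 0 ≤ e := (norm_nonneg U).trans hU
  have hs := re_csqrt_mul₃_pos (hU.trans he) (hV.trans he) (hW.trans he)
  have hsq : (csqrt (1 - U) * csqrt (1 - V) * csqrt (1 - W)) ^ 2 =
      1 + ((U * V - W ^ 2) - U * V * W) := by
    rw [mul_pow, mul_pow, csqrt_sq, csqrt_sq, csqrt_sq, h0]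
    ring
  have h2 := norm_E₂_le hU hV hW h0
  have h3 := norm_E₃_le hU hV hW
  set s := csqrt (1 - U) * csqrt (1 - V) * csqrt (1 - W)
  set a := U * V - W ^ 2
  set b := U * V * W
  have hw : ‖a - b‖ ≤ 1.811 * e ^ 2 := by
    refine (norm_sub_le _ _).trans ?_
    nlinarith [mul_nonneg (sq_nonneg e) (sub_nonneg.2 he)]
  have hw' : ‖a - b‖ ≤ 0.1752 := by nlinarith
  have hmain := norm_inv_sub_quadratic_le hs hsq hw'
  have hw3 : ‖a - b‖ ^ 3 ≤ 5.94 * e ^ 6 :=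
    calc ‖a - b‖ ^ 3 ≤ (1.811 * e ^ 2) ^ 3 := by gcongr
      _ = 1.811 ^ 3 * e ^ 6 := by ring
      _ ≤ _ := by gcongr; norm_num
  have hb : ‖3 / 8 * b ^ 2‖ ≤ 3 / 8 * e ^ 6 := by
    rw [norm_mul, norm_pow, show e ^ 6 = (e ^ 3) ^ 2 by ring]
    have : ‖(3 / 8 : ℂ)‖ = 3 / 8 := by norm_num
    rw [this]
    gcongr
  have he6 : 0 ≤ e ^ 6 := by positivity
  rw [show s⁻¹ - (1 - a / 2 + b / 2 + 3 / 8 * a ^ 2 - 3 / 4 * (a * b)) =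
    (s⁻¹ - (1 - (a - b) / 2 + 3 / 8 * (a - b) ^ 2)) + 3 / 8 * b ^ 2 by ring]
  refine (norm_add_le _ _).trans ?_
  linarith

/-- The factorization `t + (1 - v) = (t + 1) (1 - u v)` with `u = 1 / (t + 1)`, applied to each of
the three factors. -/
theorem kern_one_sub {U V W : ℂ} (hU : ‖U‖ < 1) (hV : ‖V‖ < 1) (hW : ‖W‖ < 1) {t : ℝ}
    (ht : 0 < t) : kern (1 - U) (1 - V) (1 - W) t = ((t + 1) ^ (-3 / 2 : ℝ) : ℝ) *
      (csqrt (1 - ((t + 1)⁻¹ : ℝ) * U) * csqrt (1 - ((t + 1)⁻¹ : ℝ) * V) *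
        csqrt (1 - ((t + 1)⁻¹ : ℝ) * W))⁻¹ := by
  have ht1 : 0 < t + 1 := by linarith
  have hs : (t + 1)⁻¹ ∈ Icc (0 : ℝ) 1 := ⟨by positivity, inv_le_one_of_one_le₀ (by linarith)⟩
  have hne : (t : ℂ) + 1 ≠ 0 := by exact_mod_cast ht1.ne'
  have e : ∀ {v : ℂ}, ‖v‖ < 1 → csqrt (t + (1 - v)) =
      (√(t + 1) : ℝ) * csqrt (1 - ((t + 1)⁻¹ : ℝ) * v) := fun {v} hv => by
    have hslit : 1 - (((t + 1)⁻¹ : ℝ) : ℂ) * v ∈ Complex.slitPlane :=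
      Complex.mem_slitPlane_iff.2 (.inl (one_sub_mul_re_pos hv hs))
    rw [← csqrt_ofReal ht1, ← csqrt_mul_ofReal ht1 hslit]
    congr 1
    push_cast
    field_simp
    ring
  rw [kern, e hU, e hV, e hW, ← inv_sqrt_cube ht1]
  push_cast
  rw [← mul_inv]
  congr 1
  ring

/-- The sum of the terms of degree at most `5` of the expansion of `RF (1 - U) (1 - V) (1 - W)`,
in terms of `a = E₂` and `b = E₃`. -/
noncomputable def quintic (a b : ℂ) : ℂ :=
  1 - 1 / 10 * a + 1 / 14 * b + 1 / 24 * a ^ 2 - 3 / 44 * (a * b)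

theorem integral_ofReal_rpow {p : ℝ} (hp : p < -1) (c : ℂ) :
    IntegrableOn (fun t : ℝ => c * (((t + 1) ^ p : ℝ) : ℂ)) (Ioi 0) ∧
    ∫ t in Ioi (0 : ℝ), c * (((t + 1) ^ p : ℝ) : ℂ) = c * ((-1 / (p + 1) : ℝ) : ℂ) := by
  constructor
  · exact (integrableOn_add_rpow_Ioi_of_lt hp (by norm_num)).ofReal.const_mul c
  · rw [integral_const_mul, integral_complex_ofReal, integral_add_rpow_Ioi hp one_pos,
      Real.one_rpow]

/-- A term of degree `k` contributes the factor `1 / 2 * ∫ (t + 1)^{-3/2 - k} = 1 / (2 k + 1)`,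
which turns the polynomial of `norm_prod_sub_le` into `quintic` and divides its error, of degree
`6`, by `13`. -/
theorem norm_RF_sub_quintic_le {U V W : ℂ} {e : ℝ} (hU : ‖U‖ ≤ e) (hV : ‖V‖ ≤ e) (hW : ‖W‖ ≤ e)
    (he : e ≤ 0.311) (h0 : W = -U - V) :
    ‖RF (1 - U) (1 - V) (1 - W) - quintic (U * V - W ^ 2) (U * V * W)‖ ≤ 3.3 / 13 * e ^ 6 := by
  have hlt : ∀ {v : ℂ}, ‖v‖ ≤ e → ‖v‖ < 1 := fun h => by linarith
  have hs : ∀ {v : ℂ}, ‖v‖ ≤ e → 1 - v ∈ Complex.slitPlane := fun hv =>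
    one_sub_mem_slitPlane (hlt hv)
  set a := U * V - W ^ 2 with ha
  set b := U * V * W with hb
  obtain ⟨i0, j0⟩ := integral_ofReal_rpow (p := -3 / 2) (by norm_num) 1
  obtain ⟨i2, j2⟩ := integral_ofReal_rpow (p := -7 / 2) (by norm_num) (a / 2)
  obtain ⟨i3, j3⟩ := integral_ofReal_rpow (p := -9 / 2) (by norm_num) (b / 2)
  obtain ⟨i4, j4⟩ := integral_ofReal_rpow (p := -11 / 2) (by norm_num) (3 / 8 * a ^ 2)
  obtain ⟨i5, j5⟩ := integral_ofReal_rpow (p := -13 / 2) (by norm_num) (3 / 4 * (a * b))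
  have hsub : ∀ {f g : ℝ → ℂ}, IntegrableOn f (Ioi 0) → IntegrableOn g (Ioi 0) →
      IntegrableOn (fun t => f t - g t) (Ioi 0) := fun hf hg => hf.sub hg
  have i02 := hsub i0 i2
  have i03 := Integrable.fun_add i02 i3
  have i04 := Integrable.fun_add i03 i4
  have i05 := hsub i04 i5
  have hpol : quintic a b = 1 / 2 * ∫ t in Ioi (0 : ℝ),
      (1 * (((t + 1) ^ (-3 / 2 : ℝ) : ℝ) : ℂ) - a / 2 * (((t + 1) ^ (-7 / 2 : ℝ) : ℝ) : ℂ) +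
        b / 2 * (((t + 1) ^ (-9 / 2 : ℝ) : ℝ) : ℂ) +
        3 / 8 * a ^ 2 * (((t + 1) ^ (-11 / 2 : ℝ) : ℝ) : ℂ) -
        3 / 4 * (a * b) * (((t + 1) ^ (-13 / 2 : ℝ) : ℝ) : ℂ)) := by
    rw [integral_sub i04 i5, integral_add i03 i4, integral_add i02 i3, integral_sub i0 i2,
      j0, j2, j3, j4, j5, quintic]
    push_cast
    ring
  have hk := (Admissible.of_mem_slitPlane (hs hU) (hs hV) (hs hW)).integrableOn_kern
  have hrem := (integrableOn_add_rpow_Ioi_of_lt (a := -15 / 2) (m := 1) (c := 0) (by norm_num)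
    (by norm_num)).const_mul (3.3 * e ^ 6)
  rw [RF_eq_kern, hpol, ← mul_sub, ← integral_sub hk i05, norm_mul]
  have hbd : ∀ t ∈ Ioi (0 : ℝ), ‖kern (1 - U) (1 - V) (1 - W) t -
      (1 * (((t + 1) ^ (-3 / 2 : ℝ) : ℝ) : ℂ) - a / 2 * (((t + 1) ^ (-7 / 2 : ℝ) : ℝ) : ℂ) +
        b / 2 * (((t + 1) ^ (-9 / 2 : ℝ) : ℝ) : ℂ) +
        3 / 8 * a ^ 2 * (((t + 1) ^ (-11 / 2 : ℝ) : ℝ) : ℂ) -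
        3 / 4 * (a * b) * (((t + 1) ^ (-13 / 2 : ℝ) : ℝ) : ℂ))‖ ≤
      3.3 * e ^ 6 * (t + 1) ^ (-15 / 2 : ℝ) := fun t ht => by
    have ht0 : (0 : ℝ) < t := ht
    have ht1 : 0 < t + 1 := by linarith
    have hp : ∀ k : ℕ, ∀ p : ℝ, p = -3 / 2 - k →
        (t + 1) ^ p = (t + 1) ^ (-3 / 2 : ℝ) * (t + 1)⁻¹ ^ k := fun k p h => by
      rw [h, Real.rpow_sub_natCast ht1.ne', inv_pow, div_eq_mul_inv]
    rw [kern_one_sub (hlt hU) (hlt hV) (hlt hW) ht0, hp 2 (-7 / 2) (by norm_num),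
      hp 3 (-9 / 2) (by norm_num), hp 4 (-11 / 2) (by norm_num), hp 5 (-13 / 2) (by norm_num),
      hp 6 (-15 / 2) (by norm_num)]
    have hP : 0 ≤ (t + 1) ^ (-3 / 2 : ℝ) := by positivity
    have hu0 : 0 ≤ (t + 1)⁻¹ := by positivity
    have hu1 : (t + 1)⁻¹ ≤ 1 := inv_le_one_of_one_le₀ (by linarith)
    generalize (t + 1) ^ (-3 / 2 : ℝ) = P at *
    generalize (t + 1)⁻¹ = u at *
    have hsc : ∀ {v : ℂ}, ‖v‖ ≤ e → ‖(u : ℂ) * v‖ ≤ u * e := fun h => by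
      rw [norm_mul, Complex.norm_of_nonneg hu0]
      gcongr
    have he0 : 0 ≤ e := (norm_nonneg U).trans hU
    have hmain := norm_prod_sub_le (hsc hU) (hsc hV) (hsc hW) (by nlinarith)
      (by rw [h0]; ring)
    have e2 : (u : ℂ) * U * (u * V) - (u * W) ^ 2 = u ^ 2 * a := by rw [ha]; ring
    have e3 : (u : ℂ) * U * (u * V) * (u * W) = u ^ 3 * b := by rw [hb]; ring
    rw [e2, e3] at hmain
    have hfin := mul_le_mul_of_nonneg_left hmain hP
    rw [← Complex.norm_of_nonneg hP, ← norm_mul, Complex.norm_of_nonneg hP] at hfin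
    refine le_trans (le_of_eq ?_) (hfin.trans (le_of_eq ?_))
    · congr 1
      push_cast
      ring
    · ring
  have hfin := norm_integral_le_of_norm_le hrem
    ((ae_restrict_iff' measurableSet_Ioi).2 (ae_of_all _ hbd))
  rw [integral_const_mul, integral_add_rpow_Ioi (by norm_num) one_pos, Real.one_rpow] at hfin
  have h2 : ‖(1 / 2 : ℂ)‖ = 1 / 2 := by norm_num
  rw [h2]
  refine (mul_le_mul_of_nonneg_left hfin (by norm_num)).trans (le_of_eq ?_)
  norm_num
  ring

theorem le_norm_quintic {a b : ℂ} (ha : ‖a‖ ≤ 0.146) (hb : ‖b‖ ≤ 0.0301) :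
    0.97 ≤ ‖quintic a b‖ := by
  have h1 : ‖1 / 10 * a - 1 / 14 * b - 1 / 24 * a ^ 2 + 3 / 44 * (a * b)‖ ≤
      1 / 10 * ‖a‖ + 1 / 14 * ‖b‖ + 1 / 24 * ‖a‖ ^ 2 + 3 / 44 * (‖a‖ * ‖b‖) := by
    refine (norm_add_le _ _).trans ?_
    refine (add_le_add_left ((norm_sub_le _ _).trans (add_le_add_left (norm_sub_le _ _) _)) _).trans
      (le_of_eq ?_)
    simp only [norm_mul, norm_div, norm_pow, Complex.norm_ofNat, norm_one]
  have h2 : ‖a‖ ^ 2 ≤ 0.146 ^ 2 := by gcongr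
  have h3 : ‖a‖ * ‖b‖ ≤ 0.146 * 0.0301 := by gcongr
  have h4 := norm_sub_norm_le (1 : ℂ)
    (1 / 10 * a - 1 / 14 * b - 1 / 24 * a ^ 2 + 3 / 44 * (a * b))
  rw [norm_one] at h4
  rw [quintic, show 1 - 1 / 10 * a + 1 / 14 * b + 1 / 24 * a ^ 2 - 3 / 44 * (a * b) =
    1 - (1 / 10 * a - 1 / 14 * b - 1 / 24 * a ^ 2 + 3 / 44 * (a * b)) by ring]
  linarith

/-! ### The error of the algorithm -/

theorem approxRF_eq (x y z : ℂ) (n : ℕ) : approxRF x y z n =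
    (csqrt (A x y z n))⁻¹ * quintic (E₂ x y z n) (E₃ x y z n) := by
  rw [approxRF, cpow_neg_half, quintic]

theorem Stop.A_ne_zero {r : ℝ} {x y z : ℂ} {n : ℕ} (hr : 0 < r) (h : Stop r x y z n) :
    A x y z n ≠ 0 := by
  rw [← norm_pos_iff]
  refine lt_of_le_of_lt ?_ h
  rw [Q]
  positivity

/-- For `d = A_0 - x`, `A_0 - y`, `A_0 - z` this bounds `X`, `Y`, `Z` by `(3 r)^{1/6}`. -/
theorem Stop.norm_lt {r : ℝ} {x y z : ℂ} {n : ℕ} (hr : 0 < r) (h : Stop r x y z n) {d : ℂ}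
    (hd : ‖d‖ ≤ max ‖A x y z 0 - x‖ (max ‖A x y z 0 - y‖ ‖A x y z 0 - z‖)) :
    ‖d / (4 ^ n * A x y z n)‖ < (3 * r) ^ (1 / 6 : ℝ) := by
  have hA := norm_pos_iff.2 (h.A_ne_zero hr)
  have h3r : 0 < 3 * r := by linarith
  rw [Stop, Q, div_lt_iff₀ (by positivity), neg_div, Real.rpow_neg h3r.le,
    inv_mul_lt_iff₀ (by positivity)] at h
  rw [norm_div, norm_mul, norm_pow, Complex.norm_ofNat, div_lt_iff₀ (by positivity)]
  calc ‖d‖ ≤ _ := hd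
    _ < _ := h
    _ = _ := by ring

theorem iter_eq_mul {a p d : ℂ} {n : ℕ} (ha : a ≠ 0) (h : a - p = d / 4 ^ n) :
    p = a * (1 - d / (4 ^ n * a)) := by
  rw [← div_div, ← h]
  field_simp
  ring

theorem Z_eq (x y z : ℂ) (n : ℕ) : Z x y z n = (A x y z 0 - z) / (4 ^ n * A x y z n) := by
  rw [Z, X, Y, ← neg_div, ← sub_div]
  congr 1
  rw [A]
  ring

theorem rpow_sixth_bounds {r : ℝ} (hr0 : 0 < r) (hr : r < 3 * (10 : ℝ) ^ (-4 : ℤ)) :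
    ((3 * r) ^ (1 / 6 : ℝ)) ^ 6 = 3 * r ∧ (3 * r) ^ (1 / 6 : ℝ) ≤ 0.311 := by
  have h6 : ((3 * r) ^ (1 / 6 : ℝ)) ^ 6 = 3 * r := by
    rw [← Real.rpow_natCast, ← Real.rpow_mul (by positivity)]
    norm_num
  refine ⟨h6, le_of_pow_le_pow_left₀ (n := 6) (by norm_num) (by norm_num) ?_⟩
  rw [h6]
  norm_num at hr ⊢
  linarith

theorem norm_RF_sub_approxRF_lt {x y z : ℂ} {r : ℝ} (h : Admissible x y z) (hr0 : 0 < r)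
    (hr : r < 3 * (10 : ℝ) ^ (-4 : ℤ)) {n : ℕ} (hn : Stop r x y z n)
    (hhull : HullCondition (iter x y z n).1 (iter x y z n).2.1 (iter x y z n).2.2) :
    ‖RF x y z - approxRF x y z n‖ < r * ‖approxRF x y z n‖ := by
  have hA := hn.A_ne_zero hr0
  obtain ⟨he6, he⟩ := rpow_sixth_bounds hr0 hr
  have hX : ‖X x y z n‖ < (3 * r) ^ (1 / 6 : ℝ) := hn.norm_lt hr0 (le_max_left _ _)
  have hY : ‖Y x y z n‖ < (3 * r) ^ (1 / 6 : ℝ) :=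
    hn.norm_lt hr0 ((le_max_left _ _).trans (le_max_right _ _))
  have hZ : ‖Z x y z n‖ < (3 * r) ^ (1 / 6 : ℝ) := by
    rw [Z_eq]
    exact hn.norm_lt hr0 ((le_max_right _ _).trans (le_max_right _ _))
  have he0 : 0 < (3 * r) ^ (1 / 6 : ℝ) := by positivity
  set e := (3 * r) ^ (1 / 6 : ℝ)
  obtain ⟨hx, hy, hz⟩ := A_sub_iter x y z n
  have hRF := hhull.RF_eq hA (hX.trans (by linarith)) (hY.trans (by linarith))
    (hZ.trans (by linarith)) (A_eq_mean x y z n) (iter_eq_mul hA hx) (iter_eq_mul hA hy)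
    (by rw [Z_eq]; exact iter_eq_mul hA hz)
  have herr := norm_RF_sub_quintic_le hX.le hY.le hZ.le he rfl
  have he2 : e ^ 2 ≤ 0.311 ^ 2 := by gcongr
  have he3 : e ^ 3 ≤ 0.311 ^ 3 := by gcongr
  have hlow : 0.97 ≤ ‖quintic (E₂ x y z n) (E₃ x y z n)‖ := by
    refine le_norm_quintic ((norm_E₂_le hX.le hY.le hZ.le rfl).trans ?_)
      ((norm_E₃_le hX.le hY.le hZ.le).trans ?_)
    · linarith
    · linarith
  rw [RF_iter h n, hRF, approxRF_eq, ← mul_sub, norm_mul, norm_mul, mul_left_comm]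
  refine mul_lt_mul_of_pos_left ?_ (norm_pos_iff.2 (inv_ne_zero (csqrt_ne_zero hA)))
  calc _ ≤ 3.3 / 13 * e ^ 6 := herr
    _ < r * 0.97 := by rw [he6]; linarith
    _ ≤ _ := by gcongr

theorem eq_zero_or_mem_slitPlane {v : ℂ} (h : v ≠ 0 → |v.arg| < Real.pi) :
    v = 0 ∨ v ∈ Complex.slitPlane := by
  refine or_iff_not_imp_left.2 fun hv => Complex.mem_slitPlane_iff_arg.2 ⟨fun h1 => ?_, hv⟩
  have := h hv
  rw [h1, abs_of_pos Real.pi_pos] at this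
  exact lt_irrefl _ this

end Carlson

theorem mainTheorem1 (x y z : ℂ) (r : ℝ)
    (hxy : x ≠ 0 ∨ y ≠ 0) (hxz : x ≠ 0 ∨ z ≠ 0) (hyz : y ≠ 0 ∨ z ≠ 0)
    (hx : x ≠ 0 → |x.arg| < Real.pi) (hy : y ≠ 0 → |y.arg| < Real.pi)
    (hz : z ≠ 0 → |z.arg| < Real.pi)
    (hr0 : 0 < r) (hr : r < 3 * (10 : ℝ) ^ (-4 : ℤ)) :
    IntegrableOn (Carlson.integrandRF x y z) (Set.Ioi 0) ∧
    (∃ n : ℕ, 1 ≤ n ∧ Carlson.Stop r x y z n) ∧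
    ∀ n : ℕ, Carlson.Stop r x y z n →
      (n = 0 → convexHull ℝ {x, y, z} ⊆ insert 0 Complex.slitPlane) →
      ‖Carlson.RF x y z - Carlson.approxRF x y z n‖ < r * ‖Carlson.approxRF x y z n‖ := by
  have h : Carlson.Admissible x y z :=
    ⟨Carlson.eq_zero_or_mem_slitPlane hx, Carlson.eq_zero_or_mem_slitPlane hy,
      Carlson.eq_zero_or_mem_slitPlane hz, hxy, hxz, hyz⟩
  refine ⟨?_, Carlson.exists_stop r h, fun n hn hhull => ?_⟩
  · rw [funext (Carlson.integrandRF_eq_kern x y z)]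
    exact h.integrableOn_kern
  · refine Carlson.norm_RF_sub_approxRF_lt h hr0 hr hn ?_
    cases n with
    | zero => exact Carlson.hullCondition_of_convexHull_subset (hhull rfl)
    | succ n => exact h.hullCondition_iter_succ n
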